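/- Let $n\ge 1$. Let $OS_2^+(n)$ be the commutative associative unital $\mathbb{Q}$-algebra with generators $x_{ij}, y_{ij}$ ($1\le i\ne j\le n$) and relations $$x_{ij}+x_{ji}=y_{ij}+y_{ji}=0,\qquad x_{ij}^2=x_{ij}y_{ij}=y_{ij}^2=0,$$ and, for all pairwise distinct $i,j,k$, $$x_{ij}x_{jk}+x_{jk}x_{ki}+x_{ki}x_{ij}=0,\qquad y_{ij}y_{jk}+y_{jk}y_{ki}+y_{ki}y_{ij}=0,$$ $$x_{ij}y_{jk}+x_{jk}y_{ki}+x_{ki}y_{ij}+y_{ij}x_{jk}+y_{jk}x_{ki}+y_{ki}x_{ij}=0.$$ The group $SL_2(\mathbb{Q})$ acts on $OS_2^+(n)$ by algebra automorphisms, where $g=\begin{pmatrix}a&b\\c&d\end{pmatrix}$ acts on generators by $x_{ij}\mapsto a\,x_{ij}+c\,y_{ij}$ and $y_{ij}\mapsto b\,x_{ij}+d\,y_{ij}$. For $m\in\mathbb{Z}$ let $V_m\subset OS_2^+(n)$ be the weight space of all $v$ such that $\mathrm{diag}(t,t^{-1})\cdot v=t^m v$ for all $t\in\mathbb{Q}^\times$.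 Then $OS_2^+(n)$ is finite-dimensional, it is the direct sum of its weight spaces $V_m$, and its $SL_2$-character is $$\sum_{m\in\mathbb{Z}}\dim_{\mathbb{Q}}(V_m)\,q^m=\prod_{k=1}^{n-1}\bigl(1+kq+(n-k)q^{-1}\bigr)\quad\text{in }\mathbb{Z}[q,q^{-1}].$$ -/

import Mathlib

open scoped LaurentPolynomial

noncomputable section

namespace DoubleOS

/-- The generators `x_{ij}`, `y_{ij}`, for `i ≠ j` in `{1, …, n}`. -/
inductive Gen (n : ℕ) : Type
  | x (i j : Fin n) (h : i ≠ j) : Gen n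
  | y (i j : Fin n) (h : i ≠ j) : Gen n

open MvPolynomial in
/-- The defining relations; `Rel n p` says that `p = 0` is one of them. -/
inductive Rel (n : ℕ) : MvPolynomial (Gen n) ℚ → Prop
  | anti_x (i j : Fin n) (h : i ≠ j) :
      Rel n (X (.x i j h) + X (.x j i h.symm))
  | anti_y (i j : Fin n) (h : i ≠ j) :
      Rel n (X (.y i j h) + X (.y j i h.symm))
  | arnold_xx (i j k : Fin n) (hij : i ≠ j) (hjk : j ≠ k) (hki : k ≠ i) :
      Rel n (X (.x i j hij) * X (.x j k hjk) + X (.x j k hjk) * X (.x k i hki)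
        + X (.x k i hki) * X (.x i j hij))
  | arnold_xy (i j k : Fin n) (hij : i ≠ j) (hjk : j ≠ k) (hki : k ≠ i) :
      Rel n (X (.x i j hij) * X (.y j k hjk) + X (.x j k hjk) * X (.y k i hki)
        + X (.x k i hki) * X (.y i j hij) + X (.y i j hij) * X (.x j k hjk)
        + X (.y j k hjk) * X (.x k i hki) + X (.y k i hki) * X (.x i j hij))
  | arnold_yy (i j k : Fin n) (hij : i ≠ j) (hjk : j ≠ k) (hki : k ≠ i) :
      Rel n (X (.y i j hij) * X (.y j k hjk) + X (.y j k hjk) * X (.y k i hki)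
        + X (.y k i hki) * X (.y i j hij))
  | sq_xx (i j : Fin n) (h : i ≠ j) : Rel n (X (.x i j h) ^ 2)
  | sq_xy (i j : Fin n) (h : i ≠ j) : Rel n (X (.x i j h) * X (.y i j h))
  | sq_yy (i j : Fin n) (h : i ≠ j) : Rel n (X (.y i j h) ^ 2)

/-- The ideal generated by the relations. -/
def relIdeal (n : ℕ) : Ideal (MvPolynomial (Gen n) ℚ) :=
  Ideal.span {p | Rel n p}

/-- The double even Orlik–Solomon algebra over `ℚ`: the generators are even, so it is the
commutative algebra with these generators and relations. -/
abbrev OS2Plus (n : ℕ) : Type :=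
  MvPolynomial (Gen n) ℚ ⧸ relIdeal n

/-- `SL₂` over the ground field. -/
abbrev SL2 : Type := Matrix.SpecialLinearGroup (Fin 2) ℚ

open MvPolynomial in
/-- The action of `g = (a b; c d)` on generators: each pair `(x_{ij}, y_{ij})` is transformed as the
standard basis of the natural representation, `x_{ij} ↦ a x_{ij} + c y_{ij}`,
`y_{ij} ↦ b x_{ij} + d y_{ij}`. -/
def genAct {n : ℕ} (g : SL2) : Gen n → MvPolynomial (Gen n) ℚ
  | .x i j h => C (g.1 0 0) * X (.x i j h) + C (g.1 1 0) * X (.y i j h)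
  | .y i j h => C (g.1 0 1) * X (.x i j h) + C (g.1 1 1) * X (.y i j h)

/-- The extension of the action on generators to the free commutative algebra. -/
def freeAct {n : ℕ} (g : SL2) : MvPolynomial (Gen n) ℚ →ₐ[ℚ] MvPolynomial (Gen n) ℚ :=
  MvPolynomial.aeval (genAct g)

open MvPolynomial in
theorem freeAct_rel {n : ℕ} (g : SL2) {p : MvPolynomial (Gen n) ℚ} (hp : Rel n p) :
    freeAct g p ∈ relIdeal n := by
  have mem : ∀ {q : MvPolynomial (Gen n) ℚ}, Rel n q → q ∈ relIdeal n :=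
    fun hq => Ideal.subset_span hq
  have lin2 : ∀ {q r : MvPolynomial (Gen n) ℚ} (a b : MvPolynomial (Gen n) ℚ),
      Rel n q → Rel n r → a * q + b * r ∈ relIdeal n := fun a b hq hr =>
    Ideal.add_mem _ (Ideal.mul_mem_left _ a (mem hq)) (Ideal.mul_mem_left _ b (mem hr))
  have lin3 : ∀ {q r s : MvPolynomial (Gen n) ℚ} (a b c : MvPolynomial (Gen n) ℚ),
      Rel n q → Rel n r → Rel n s → a * q + b * r + c * s ∈ relIdeal n :=
    fun a b c hq hr hs =>
      Ideal.add_mem _ (lin2 a b hq hr) (Ideal.mul_mem_left _ c (mem hs))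
  cases hp with
  | anti_x i j h =>
    convert lin2 (C (g.1 0 0)) (C (g.1 1 0)) (Rel.anti_x i j h) (Rel.anti_y i j h) using 1
    simp only [freeAct, map_add, aeval_X, genAct]; ring
  | anti_y i j h =>
    convert lin2 (C (g.1 0 1)) (C (g.1 1 1)) (Rel.anti_x i j h) (Rel.anti_y i j h) using 1
    simp only [freeAct, map_add, aeval_X, genAct]; ring
  | arnold_xx i j k hij hjk hki =>
    convert lin3 (C (g.1 0 0) ^ 2) (C (g.1 0 0) * C (g.1 1 0)) (C (g.1 1 0) ^ 2)
      (Rel.arnold_xx i j k hij hjk hki) (Rel.arnold_xy i j k hij hjk hki)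
      (Rel.arnold_yy i j k hij hjk hki) using 1
    simp only [freeAct, map_add, map_mul, aeval_X, genAct]; ring
  | arnold_xy i j k hij hjk hki =>
    convert lin3 (2 * C (g.1 0 0) * C (g.1 0 1))
      (C (g.1 0 0) * C (g.1 1 1) + C (g.1 1 0) * C (g.1 0 1)) (2 * C (g.1 1 0) * C (g.1 1 1))
      (Rel.arnold_xx i j k hij hjk hki) (Rel.arnold_xy i j k hij hjk hki)
      (Rel.arnold_yy i j k hij hjk hki) using 1
    simp only [freeAct, map_add, map_mul, aeval_X, genAct]; ring
  | arnold_yy i j k hij hjk hki =>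
    convert lin3 (C (g.1 0 1) ^ 2) (C (g.1 0 1) * C (g.1 1 1)) (C (g.1 1 1) ^ 2)
      (Rel.arnold_xx i j k hij hjk hki) (Rel.arnold_xy i j k hij hjk hki)
      (Rel.arnold_yy i j k hij hjk hki) using 1
    simp only [freeAct, map_add, map_mul, aeval_X, genAct]; ring
  | sq_xx i j h =>
    convert lin3 (C (g.1 0 0) ^ 2) (2 * C (g.1 0 0) * C (g.1 1 0)) (C (g.1 1 0) ^ 2)
      (Rel.sq_xx i j h) (Rel.sq_xy i j h) (Rel.sq_yy i j h) using 1
    simp only [freeAct, map_pow, aeval_X, genAct]; ring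
  | sq_xy i j h =>
    convert lin3 (C (g.1 0 0) * C (g.1 0 1))
      (C (g.1 0 0) * C (g.1 1 1) + C (g.1 1 0) * C (g.1 0 1)) (C (g.1 1 0) * C (g.1 1 1))
      (Rel.sq_xx i j h) (Rel.sq_xy i j h) (Rel.sq_yy i j h) using 1
    simp only [freeAct, map_mul, aeval_X, genAct]; ring
  | sq_yy i j h =>
    convert lin3 (C (g.1 0 1) ^ 2) (2 * C (g.1 0 1) * C (g.1 1 1)) (C (g.1 1 1) ^ 2)
      (Rel.sq_xx i j h) (Rel.sq_xy i j h) (Rel.sq_yy i j h) using 1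
    simp only [freeAct, map_pow, aeval_X, genAct]; ring

theorem freeAct_mem {n : ℕ} (g : SL2) :
    relIdeal n ≤ (relIdeal n).comap (freeAct g) :=
  Ideal.span_le.2 fun _ hp => freeAct_rel g hp

open MvPolynomial in
theorem freeAct_one {n : ℕ} : freeAct (n := n) 1 = AlgHom.id ℚ _ := by
  refine MvPolynomial.algHom_ext fun e => ?_
  cases e <;> simp [freeAct, genAct]

open MvPolynomial in
theorem freeAct_mul {n : ℕ} (g h : SL2) :
    freeAct (n := n) (g * h) = (freeAct g).comp (freeAct h) := by
  refine MvPolynomial.algHom_ext fun e => ?_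
  cases e <;>
    simp [freeAct, genAct, Matrix.mul_apply, Fin.sum_univ_two, algebraMap_eq] <;> ring

/-- The algebra endomorphism of the double even Orlik–Solomon algebra induced by `g`. -/
def act {n : ℕ} (g : SL2) : OS2Plus n →ₐ[ℚ] OS2Plus n :=
  Ideal.quotientMapₐ (relIdeal n) (freeAct g) (freeAct_mem g)

/-- The representation of `SL₂` on the double even Orlik–Solomon algebra. -/
def rep (n : ℕ) : Representation ℚ SL2 (OS2Plus n) where
  toFun g := (act g).toLinearMap
  map_one' := by
    refine LinearMap.ext fun v => ?_
    obtain ⟨p, rfl⟩ := Ideal.Quotient.mk_surjective v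
    simp [act, freeAct_one]
  map_mul' g h := by
    refine LinearMap.ext fun v => ?_
    obtain ⟨p, rfl⟩ := Ideal.Quotient.mk_surjective v
    simp [act, freeAct_mul]

/-- The element `diag(t, t⁻¹)` of the maximal torus of `SL₂`. -/
def torus (t : ℚˣ) : SL2 :=
  ⟨!![(t : ℚ), 0; 0, ((t⁻¹ : ℚˣ) : ℚ)], by simp [Matrix.det_fin_two_of]⟩

/-- The space of vectors of weight `m`: those on which `diag(t, t⁻¹)` acts by `t ^ m`
for every `t`. -/
def weightSpace {V : Type*} [AddCommGroup V] [Module ℚ V] (ρ : Representation ℚ SL2 V)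
    (m : ℤ) : Submodule ℚ V :=
  ⨅ t : ℚˣ, Module.End.eigenspace (ρ (torus t)) ((t ^ m : ℚˣ) : ℚ)

/-- The `SL₂`-character `∑ₘ dim V_m q ^ m` (the variable `q` is `T 1`) of a representation `V`
that is a finite-dimensional direct sum of its weight spaces `V_m`. -/
def character {V : Type*} [AddCommGroup V] [Module ℚ V] (ρ : Representation ℚ SL2 V) : ℤ[T;T⁻¹] :=
  ∑ᶠ m : ℤ, LaurentPolynomial.C (Module.finrank ℚ (weightSpace ρ m) : ℤ) * LaurentPolynomial.T m

end DoubleOS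

end

/-!
The algebra has a basis of forest monomials, which are weight vectors, so its character is a
weighted count of forests.

*Spanning.* The generators `edge c i j` are regarded as edges of colour `c` on the vertex set
`{1, …, n}`. A monomial that contains a cycle vanishes (`IsTree.edge_mul_eq_zero`), so the forest
monomials span (`mon_eq_zero_or_part`). For a tree on `S` and a vertex `m ∈ S`, removing `m` leaves
trees on the blocks of a partition of `S \ {m}`, each of which is joined to `m` by an edge of colour
`x` or `y`. Arnold's relations allow one to straighten such a monomial (`stars_le`): two `x`-edges
at `m` are merged, so that at most one block is joined to `m` by `x`; and, up to terms with more
blocks or with more vertices joined to `m` by `x`, a block can be joined to `m` by `y` at any of its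
vertices (`IsTree.sub_mul_mem_lower`), so that one choice of end per block suffices. Thus the trees
on `S` are spanned by the following products: a set `C ⊆ S \ {m}`, if it is nonempty also a vertex
of `C` joined to `m` by `x` and a basis element for the trees on `C`; and a partition of the rest
into blocks with a basis element for the trees on each block, joined to `m` by `y`.

*Independence.* Let `i ≠ j`. Identifying `i` with `j` and taking the coefficient of `edge c i j` is
a derivation (`residue`), being the `ε`-part of a homomorphism to the dual numbers. Compositions of
residues contract a vertex set to one point (`IsContr`), and they vanish on monomials that are
disconnected on this set (`IsContr.mon_mul_mon_eq_zero`). Following the recursive construction of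
the basis, each basis element is given a contraction, and the matrix of their values on the basis is
block triangular, with Kronecker products of smaller matrices of the same kind on the diagonal. The
order is by the cardinality of `C`, and for the `y`-part by the number of blocks. This recursion is
carried by `TreeSystem`, `ForestSystem` and `PlainSystem`.

*Counting.* With weight `u = q` for an `x`-edge, `v = q⁻¹` for a `y`-edge and `z` for each tree of a
forest, the recursion for the number of basis elements is solved by
`z ∏ₖ (z + k u + (m - k) v)` for forests on `m` vertices (`sum_powerset_forestPoly`,
`sum_powerset_shiftProd`). These are identities of Abel type; both sides of the key identity
`sum_choose_mul_forestPoly` have the same differences for the shift of `z` by `u - v`. For `z = 1`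
and `m = n` the product is the asserted character.
-/

noncomputable section

namespace DoubleOS

/-- The double even Orlik–Solomon algebra as a type of its own, with its ring and algebra structure
sealed, so that instance search does not look into the quotient. -/
def Alg (n : ℕ) : Type := OS2Plus n

/-- The ring and algebra structure of `Alg n`, as one definition that is not unfolded by instance
search. -/
def algStr (n : ℕ) : Σ' _ : CommRing (Alg n), Algebra ℚ (Alg n) :=
  ⟨Ideal.Quotient.commRing (relIdeal n), Ideal.Quotient.algebra ℚ⟩

instance (n : ℕ) : CommRing (Alg n) := (algStr n).1

instance (n : ℕ) : Algebra ℚ (Alg n) := (algStr n).2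

/-- The quotient map from the polynomial ring. -/
def mkAlg (n : ℕ) : MvPolynomial (Gen n) ℚ →ₐ[ℚ] Alg n := Ideal.Quotient.mkₐ ℚ (relIdeal n)

/-! ### Edges, universal property -/

/-- The generator of colour `c` (`true` for `x`, `false` for `y`) attached to the pair `i, j`, with
the convention that it vanishes for `i = j`. With this convention the defining relations hold
without any distinctness assumption. -/
def edge {n : ℕ} (c : Bool) (i j : Fin n) : Alg n :=
  if h : i = j then 0 else
    mkAlg n (MvPolynomial.X (if c then Gen.x i j h else Gen.y i j h))

section Relations

variable {n : ℕ}

theorem edge_self (c : Bool) (i : Fin n) : edge c i i = 0 := by simp [edge]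

theorem mk_eq_zero_of_rel {p : MvPolynomial (Gen n) ℚ} (h : Rel n p) :
    mkAlg n p = 0 :=
  Ideal.Quotient.eq_zero_iff_mem.2 (Ideal.subset_span h)

theorem edge_swap (c : Bool) (i j : Fin n) : edge c j i = -edge c i j := by
  rw [eq_neg_iff_add_eq_zero, add_comm]
  by_cases h : i = j
  · subst h; simp [edge_self]
  · cases c
    · simpa [edge, h, Ne.symm h, map_add] using mk_eq_zero_of_rel (Rel.anti_y i j h)
    · simpa [edge, h, Ne.symm h, map_add] using mk_eq_zero_of_rel (Rel.anti_x i j h)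

theorem edge_mul_edge (c d : Bool) (i j : Fin n) : edge c i j * edge d i j = 0 := by
  by_cases h : i = j
  · subst h; simp [edge_self]
  · have hxx := mk_eq_zero_of_rel (Rel.sq_xx i j h)
    have hxy := mk_eq_zero_of_rel (Rel.sq_xy i j h)
    have hyy := mk_eq_zero_of_rel (Rel.sq_yy i j h)
    rw [pow_two, map_mul] at hxx hyy
    rw [map_mul] at hxy
    cases c <;> cases d
    · simpa [edge, h] using hyy
    · rw [mul_comm]; simpa [edge, h] using hxy
    · simpa [edge, h] using hxy
    · simpa [edge, h] using hxx

theorem edge_mul_edge_swap (c d : Bool) (i j : Fin n) : edge c i j * edge d j i = 0 := by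
  rw [edge_swap d i j, mul_neg, edge_mul_edge, neg_zero]

/-- The Arnold relation within one colour. -/
theorem arnold_self (c : Bool) (i j k : Fin n) :
    edge c i j * edge c j k + edge c j k * edge c k i + edge c k i * edge c i j = 0 := by
  by_cases hij : i = j
  · subst hij; simp [edge_self, edge_mul_edge_swap]
  by_cases hjk : j = k
  · subst hjk; simp [edge_self, mul_comm, edge_mul_edge_swap]
  by_cases hki : k = i
  · subst hki; simp [edge_self, edge_mul_edge_swap]
  cases c
  · simpa [edge, hij, hjk, hki] using mk_eq_zero_of_rel (Rel.arnold_yy i j k hij hjk hki)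
  · simpa [edge, hij, hjk, hki] using mk_eq_zero_of_rel (Rel.arnold_xx i j k hij hjk hki)

/-- The polarised Arnold relation: it covers the relations of one colour (twice) and the mixed
one. -/
theorem arnold (c d : Bool) (i j k : Fin n) :
    edge c i j * edge d j k + edge c j k * edge d k i + edge c k i * edge d i j
      + edge d i j * edge c j k + edge d j k * edge c k i + edge d k i * edge c i j = 0 := by
  by_cases hij : i = j
  · subst hij
    linear_combination (edge d i k + edge d k i) * edge_self c i
      + (edge c i k + edge c k i) * edge_self d i + edge_mul_edge_swap c d i k
      + edge_mul_edge_swap d c i k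
  by_cases hjk : j = k
  · subst hjk
    linear_combination (edge d i j + edge d j i) * edge_self c j
      + (edge c i j + edge c j i) * edge_self d j + edge_mul_edge_swap c d i j
      + edge_mul_edge_swap d c i j
  by_cases hki : k = i
  · subst hki
    linear_combination (edge d j k + edge d k j) * edge_self c k
      + (edge c j k + edge c k j) * edge_self d k + edge_mul_edge_swap c d k j
      + edge_mul_edge_swap d c k j
  have hm : edge true i j * edge false j k + edge true j k * edge false k i
      + edge true k i * edge false i j + edge false i j * edge true j k
      + edge false j k * edge true k i + edge false k i * edge true i j = 0 := by
    simpa [edge, hij, hjk, hki] using mk_eq_zero_of_rel (Rel.arnold_xy i j k hij hjk hki)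
  cases c <;> cases d
  · linear_combination 2 * arnold_self false i j k
  · linear_combination hm
  · linear_combination hm
  · linear_combination 2 * arnold_self true i j k

/-- The universal property of the double even Orlik–Solomon algebra. -/
def lift {B : Type*} [CommRing B] [Algebra ℚ B] (E : Bool → Fin n → Fin n → B)
    (hanti : ∀ c i j, E c j i = -E c i j) (hsq : ∀ c d i j, E c i j * E d i j = 0)
    (harn : ∀ c d i j k, E c i j * E d j k + E c j k * E d k i + E c k i * E d i j
      + E d i j * E c j k + E d j k * E c k i + E d k i * E c i j = 0) :
    Alg n →ₐ[ℚ] B :=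
  Ideal.Quotient.liftₐ (relIdeal n)
    (MvPolynomial.aeval fun g : Gen n => match g with
      | .x i j _ => E true i j
      | .y i j _ => E false i j)
    (by
      have half : ∀ b : B, 2 * b = 0 → b = 0 := fun b hb => by
        have : ((1 / 2 : ℚ) • (2 * b) : B) = b := by
          rw [two_mul, ← two_smul ℚ b, smul_smul]; norm_num
        rw [← this, hb, smul_zero]
      have key : relIdeal n ≤ RingHom.ker (MvPolynomial.aeval (R := ℚ) fun g : Gen n =>
          match g with
          | .x i j _ => E true i j
          | .y i j _ => E false i j) := by
        refine Ideal.span_le.2 fun p hp => ?_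
        rw [SetLike.mem_coe, RingHom.mem_ker]
        cases hp with
        | anti_x i j h => simp [hanti true i j]
        | anti_y i j h => simp [hanti false i j]
        | arnold_xx i j k hij hjk hki =>
          simp only [map_add, map_mul, MvPolynomial.aeval_X]
          exact half _ (by linear_combination harn true true i j k)
        | arnold_xy i j k hij hjk hki =>
          simp only [map_add, map_mul, MvPolynomial.aeval_X]
          linear_combination harn true false i j k
        | arnold_yy i j k hij hjk hki =>
          simp only [map_add, map_mul, MvPolynomial.aeval_X]
          exact half _ (by linear_combination harn false false i j k)
        | sq_xx i j h => simpa [pow_two] using hsq true true i j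
        | sq_xy i j h => simpa using hsq true false i j
        | sq_yy i j h => simpa [pow_two] using hsq false false i j
      exact fun a ha => key ha)

theorem lift_edge {B : Type*} [CommRing B] [Algebra ℚ B] (E : Bool → Fin n → Fin n → B)
    (hanti hsq harn) {i j : Fin n} (hij : i ≠ j) (c : Bool) :
    lift E hanti hsq harn (edge c i j) = E c i j := by
  have key : ∀ p, lift E hanti hsq harn (mkAlg n p) = MvPolynomial.aeval (fun g : Gen n =>
      match g with
      | .x i j _ => E true i j
      | .y i j _ => E false i j) p := fun p => rfl
  cases c <;> simp [edge, hij, key]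

theorem algHom_ext {B : Type*} [CommRing B] [Algebra ℚ B] {f g : Alg n →ₐ[ℚ] B}
    (h : ∀ c i j, i ≠ j → f (edge c i j) = g (edge c i j)) : f = g := by
  refine Ideal.Quotient.algHom_ext _ (MvPolynomial.algHom_ext fun e => ?_)
  cases e with
  | x i j hij =>
    have := h true i j hij
    rw [edge, dif_neg hij] at this
    exact this
  | y i j hij =>
    have := h false i j hij
    rw [edge, dif_neg hij] at this
    exact this

/-- The augmentation, sending all generators to `0`. -/
def aug (n : ℕ) : Alg n →ₐ[ℚ] ℚ :=
  lift (fun _ _ _ => 0) (by simp) (by simp) (by simp)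

theorem aug_edge (c : Bool) (i j : Fin n) : aug n (edge c i j) = 0 := by
  by_cases h : i = j
  · subst h; simp [edge_self]
  · exact lift_edge _ _ _ _ h c

/-- The endomorphism of the algebra induced by a self-map of the set of points; the edges whose
ends become equal are sent to `0`. -/
def mapHom (f : Fin n → Fin n) : Alg n →ₐ[ℚ] Alg n :=
  lift (fun c i j => edge c (f i) (f j)) (fun c _ _ => edge_swap c _ _)
    (fun c d _ _ => edge_mul_edge c d _ _) (fun c d _ _ _ => arnold c d _ _ _)

theorem mapHom_edge (f : Fin n → Fin n) (c : Bool) (i j : Fin n) :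
    mapHom f (edge c i j) = edge c (f i) (f j) := by
  by_cases h : i = j
  · subst h; simp [edge_self]
  · exact lift_edge _ _ _ _ h c

/-- The endomorphism of the algebra that sends the edges at `r` to `0` and fixes all others. -/
def killHom (r : Fin n) : Alg n →ₐ[ℚ] Alg n :=
  lift (fun c i j => if i = r ∨ j = r then 0 else edge c i j)
    (fun c i j => by simp only [or_comm (a := j = r)]; split_ifs <;> simp [edge_swap c i j])
    (fun c d i j => by split_ifs <;> simp [edge_mul_edge])
    (fun c d i j k => by
      by_cases hi : i = r
      · simp [hi]
      by_cases hj : j = r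
      · simp [hj]
      by_cases hk : k = r
      · simp [hk]
      simpa [hi, hj, hk] using arnold c d i j k)

theorem killHom_edge (r : Fin n) (c : Bool) (i j : Fin n) :
    killHom r (edge c i j) = if i = r ∨ j = r then 0 else edge c i j := by
  by_cases h : i = j
  · subst h; simp [edge_self]
  · exact lift_edge _ _ _ _ h c

end Relations

/-! ### Residues -/

/-- The map identifying all points of `S` with `r`. -/
def collapse {n : ℕ} (S : Finset (Fin n)) (r v : Fin n) : Fin n := if v ∈ S then r else v

section Residues

variable {n : ℕ}

/-- The coefficient of `edge c i j` in `edge d k l`. -/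
def coeffEdge (c : Bool) (i j : Fin n) (d : Bool) (k l : Fin n) : Alg n :=
  if d = c then (if k = i ∧ l = j then 1 else 0) - (if k = j ∧ l = i then 1 else 0) else 0

theorem coeffEdge_swap (c : Bool) (i j : Fin n) (d : Bool) (k l : Fin n) :
    coeffEdge c i j d l k = -coeffEdge c i j d k l := by
  simp only [coeffEdge, and_comm (a := l = i), and_comm (a := l = j)]
  split_ifs <;> simp

theorem coeffEdge_eq_zero {c : Bool} {i j : Fin n} {d : Bool} {k l : Fin n}
    (h : ¬(k ∈ ({i, j} : Finset (Fin n)) ∧ l ∈ ({i, j} : Finset (Fin n)))) :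
    coeffEdge c i j d k l = 0 := by
  simp only [Finset.mem_insert, Finset.mem_singleton] at h
  simp only [coeffEdge]
  split_ifs <;> simp_all

/-- The algebra homomorphism to the dual numbers whose `ε`-part is the residue. -/
def residueHom (c : Bool) (i j : Fin n) : Alg n →ₐ[ℚ] DualNumber (Alg n) :=
  lift (fun d k l => TrivSqZeroExt.inl (edge d (collapse {i, j} i k) (collapse {i, j} i l))
      + TrivSqZeroExt.inr (coeffEdge c i j d k l))
    (fun d k l => by
      ext
      · simpa using edge_swap d _ _
      · simpa using coeffEdge_swap c i j d k l)
    (fun d d' k l => by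
      have key : ∀ d d', edge d (collapse {i, j} i k) (collapse {i, j} i l)
          * coeffEdge c i j d' k l = 0 := fun d d' => by
        by_cases h : k ∈ ({i, j} : Finset (Fin n)) ∧ l ∈ ({i, j} : Finset (Fin n))
        · simp only [collapse, if_pos h.1, if_pos h.2, edge_self, zero_mul]
        · rw [coeffEdge_eq_zero h, mul_zero]
      ext
      · simpa using edge_mul_edge d d' _ _
      · simp [key, mul_comm (coeffEdge _ _ _ _ _ _)])
    (fun d d' k l p => by
      -- A coefficient that does not vanish forces its two ends to be identified, and then the
      -- two terms it multiplies cancel.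
      have key : ∀ d d' k l p, coeffEdge c i j d' l p
          * (edge d (collapse {i, j} i k) (collapse {i, j} i l)
            + edge d (collapse {i, j} i p) (collapse {i, j} i k)) = 0 := fun d d' k l p => by
        by_cases h : l ∈ ({i, j} : Finset (Fin n)) ∧ p ∈ ({i, j} : Finset (Fin n))
        · simp only [collapse, if_pos h.1, if_pos h.2]
          rw [edge_swap d i (if k ∈ ({i, j} : Finset (Fin n)) then i else k)]
          ring
        · rw [coeffEdge_eq_zero h, zero_mul]
      ext
      · simpa using arnold d d' _ _ _
      · simp only [TrivSqZeroExt.snd_add, TrivSqZeroExt.snd_mul, TrivSqZeroExt.fst_add,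
          TrivSqZeroExt.fst_inl, TrivSqZeroExt.fst_inr, TrivSqZeroExt.snd_inl,
          TrivSqZeroExt.snd_inr, zero_add, add_zero, smul_eq_mul, MulOpposite.smul_eq_mul_unop,
          MulOpposite.unop_op, TrivSqZeroExt.snd_zero]
        linear_combination key d d' k l p + key d d' l p k + key d d' p k l
          + key d' d k l p + key d' d l p k + key d' d p k l)

theorem residueHom_edge (c : Bool) (i j : Fin n) (d : Bool) (k l : Fin n) :
    residueHom c i j (edge d k l) =
      TrivSqZeroExt.inl (edge d (collapse {i, j} i k) (collapse {i, j} i l))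
      + TrivSqZeroExt.inr (coeffEdge c i j d k l) := by
  by_cases h : k = l
  · subst h
    have : coeffEdge c i j d k k = 0 := by
      simp only [coeffEdge, and_comm (a := k = j)]; split_ifs <;> simp
    simp only [edge_self, this, map_zero, TrivSqZeroExt.inl_zero, TrivSqZeroExt.inr_zero, add_zero]
  · exact lift_edge _ _ _ _ h d

/-- The residue along `edge c i j`, with `j` identified with `i` afterwards. -/
def residue (c : Bool) (i j : Fin n) : Alg n →ₗ[ℚ] Alg n :=
  (TrivSqZeroExt.sndHom (Alg n) (Alg n)).restrictScalars ℚ ∘ₗ (residueHom c i j).toLinearMap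

theorem residue_mul (c : Bool) (i j : Fin n) (a b : Alg n) :
    residue c i j (a * b) = mapHom (collapse {i, j} i) a * residue c i j b
      + residue c i j a * mapHom (collapse {i, j} i) b := by
  have key : (TrivSqZeroExt.fstHom ℚ (Alg n) (Alg n)).comp (residueHom c i j)
      = mapHom (collapse {i, j} i) :=
    algHom_ext fun d k l _ => by simp [residueHom_edge, mapHom_edge]
  have h : ∀ p, mapHom (collapse {i, j} i) p = (residueHom c i j p).fst := fun p => by
    rw [← key]; rfl
  simp only [h]
  simp [residue, TrivSqZeroExt.snd_mul, mul_comm]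

theorem residue_edge (c : Bool) (i j : Fin n) (d : Bool) (k l : Fin n) :
    residue c i j (edge d k l) = coeffEdge c i j d k l := by
  simp [residue, residueHom_edge]

theorem residue_one (c : Bool) (i j : Fin n) : residue c i j (1 : Alg n) = 0 := by
  simp [residue]

end Residues

/-! ### Tree and forest monomials -/

section Trees

variable {n : ℕ}

/-- The monomial given by a list of coloured edges. -/
def mon (l : List (Bool × Fin n × Fin n)) : Alg n :=
  (l.map fun g => edge g.1 g.2.1 g.2.2).prod

/-- All edges of the list have both ends in `S`. -/
def Inside (S : Finset (Fin n)) (l : List (Bool × Fin n × Fin n)) : Prop :=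
  ∀ g ∈ l, g.2.1 ∈ S ∧ g.2.2 ∈ S

theorem mon_nil : mon ([] : List (Bool × Fin n × Fin n)) = 1 := rfl

theorem mon_cons (g : Bool × Fin n × Fin n) (l : List (Bool × Fin n × Fin n)) :
    mon (g :: l) = edge g.1 g.2.1 g.2.2 * mon l := by simp [mon]

theorem mon_append (l l' : List (Bool × Fin n × Fin n)) : mon (l ++ l') = mon l * mon l' := by
  simp [mon]

theorem Inside.mono {S T : Finset (Fin n)} {l : List (Bool × Fin n × Fin n)} (h : Inside S l)
    (hST : S ⊆ T) : Inside T l := fun g hg => ⟨hST (h g hg).1, hST (h g hg).2⟩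

theorem Inside.append {S : Finset (Fin n)} {l l' : List (Bool × Fin n × Fin n)} (h : Inside S l)
    (h' : Inside S l') : Inside S (l ++ l') := fun g hg =>
  (List.mem_append.1 hg).elim (h g) (h' g)

/-- A monomial whose edges form a tree on the vertex set `S`. -/
inductive IsTree : Finset (Fin n) → Alg n → Prop
  | single (v : Fin n) : IsTree {v} 1
  | join {S T : Finset (Fin n)} {a b : Alg n} {i j : Fin n} (c : Bool) (ha : IsTree S a)
      (hb : IsTree T b) (hST : Disjoint S T) (hi : i ∈ S) (hj : j ∈ T) :
      IsTree (S ∪ T) (a * b * edge c i j)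

/-- `Part w Y r a`: the element `a` is a product over the `r` blocks `D` of a partition of `Y` of
a tree monomial on `D` times a factor `w d`, for some `d ∈ D`. For `w = 1` these are the forest
monomials with `r` components; for `w = edge c m` each tree is joined to the vertex `m` by an edge
of colour `c`. -/
inductive Part (w : Fin n → Alg n) : Finset (Fin n) → ℕ → Alg n → Prop
  | nil : Part w ∅ 0 1
  | cons {D Y : Finset (Fin n)} {r : ℕ} {a b : Alg n} {d : Fin n} (hb : IsTree D b) (hd : d ∈ D)
      (hDY : Disjoint D Y) (ha : Part w Y r a) : Part w (D ∪ Y) (r + 1) (w d * b * a)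

theorem IsTree.nonempty {S : Finset (Fin n)} {a : Alg n} (h : IsTree S a) : S.Nonempty := by
  induction h with
  | single v => simp
  | join c _ _ _ hi _ _ _ => exact ⟨_, Finset.mem_union_left _ hi⟩

theorem IsTree.exists_mon {S : Finset (Fin n)} {a : Alg n} (h : IsTree S a) :
    ∃ l, Inside S l ∧ l.length + 1 = S.card ∧ mon l = a := by
  induction h with
  | single v => exact ⟨[], by simp [Inside], by simp, rfl⟩
  | @join S T a b i j c _ _ hST hi hj iha ihb =>
    obtain ⟨l, hl, hlc, rfl⟩ := iha
    obtain ⟨l', hl', hlc', rfl⟩ := ihb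
    refine ⟨(c, i, j) :: (l ++ l'), ?_, ?_, ?_⟩
    · intro g hg
      rcases List.mem_cons.1 hg with rfl | hg
      · exact ⟨Finset.mem_union_left _ hi, Finset.mem_union_right _ hj⟩
      · exact ((hl.mono Finset.subset_union_left).append
          (hl'.mono Finset.subset_union_right)) g hg
    · rw [Finset.card_union_of_disjoint hST]; simp; omega
    · rw [mon_cons, mon_append]; ring

/-- A tree can be cut at the edge at `j` that leads towards `i`; the factor `u` is a sign. -/
theorem IsTree.split {S : Finset (Fin n)} {a : Alg n} (h : IsTree S a) :
    ∀ {i j : Fin n}, i ∈ S → j ∈ S → i ≠ j → ∃ S₁ S₂ a₁ a₂ c q u, IsTree S₁ a₁ ∧ IsTree S₂ a₂ ∧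
      Disjoint S₁ S₂ ∧ S₁ ∪ S₂ = S ∧ i ∈ S₁ ∧ q ∈ S₁ ∧ j ∈ S₂ ∧ a = u * (a₁ * a₂ * edge c q j) := by
  induction h with
  | single v =>
    intro i j hi hj hij
    rw [Finset.mem_singleton] at hi hj
    exact absurd (hi.trans hj.symm) hij
  | @join S T a b k l c ha hb hST hk hl iha ihb =>
    intro i j hi hj hij
    -- The same statement with the two sides exchanged is needed for both orders of the ends, so
    -- it is proved for a general pair of trees.
    have aux : ∀ {S T : Finset (Fin n)} {a b : Alg n} {k l : Fin n} (c : Bool), IsTree S a →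
        IsTree T b → Disjoint S T → k ∈ S → l ∈ T →
        (∀ {i j : Fin n}, i ∈ S → j ∈ S → i ≠ j → ∃ S₁ S₂ a₁ a₂ c q u, IsTree S₁ a₁ ∧
          IsTree S₂ a₂ ∧ Disjoint S₁ S₂ ∧ S₁ ∪ S₂ = S ∧ i ∈ S₁ ∧ q ∈ S₁ ∧ j ∈ S₂ ∧
          a = u * (a₁ * a₂ * edge c q j)) →
        (∀ {i j : Fin n}, i ∈ T → j ∈ T → i ≠ j → ∃ S₁ S₂ a₁ a₂ c q u, IsTree S₁ a₁ ∧
          IsTree S₂ a₂ ∧ Disjoint S₁ S₂ ∧ S₁ ∪ S₂ = T ∧ i ∈ S₁ ∧ q ∈ S₁ ∧ j ∈ S₂ ∧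
          b = u * (a₁ * a₂ * edge c q j)) →
        i ∈ S → j ∈ S ∪ T → ∃ S₁ S₂ a₁ a₂ c' q u, IsTree S₁ a₁ ∧ IsTree S₂ a₂ ∧
          Disjoint S₁ S₂ ∧ S₁ ∪ S₂ = S ∪ T ∧ i ∈ S₁ ∧ q ∈ S₁ ∧ j ∈ S₂ ∧
          a * b * edge c k l = u * (a₁ * a₂ * edge c' q j) := by
      intro S T a b k l c ha hb hST hk hl iha ihb hi hj
      rcases Finset.mem_union.1 hj with hj | hj
      · obtain ⟨S₁, S₂, a₁, a₂, c', q, u, h₁, h₂, hd, hu, hi, hq, hj, rfl⟩ := iha hi hj hij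
        rw [← hu] at hk hST ⊢
        rw [Finset.disjoint_union_left] at hST
        rcases Finset.mem_union.1 hk with hk | hk
        · refine ⟨S₁ ∪ T, S₂, _, a₂, c', q, u, h₁.join c hb hST.1 hk hl, h₂, ?_, ?_,
            Finset.mem_union_left _ hi, Finset.mem_union_left _ hq, hj, by ring⟩
          · exact Finset.disjoint_union_left.2 ⟨hd, hST.2.symm⟩
          · exact Finset.union_right_comm _ _ _
        · refine ⟨S₁, S₂ ∪ T, a₁, _, c', q, u, h₁, h₂.join c hb hST.2 hk hl, ?_, ?_,
            hi, hq, Finset.mem_union_left _ hj, by ring⟩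
          · exact Finset.disjoint_union_right.2 ⟨hd, hST.1⟩
          · rw [Finset.union_assoc]
      · by_cases hlj : l = j
        · subst hlj
          exact ⟨S, T, a, b, c, k, 1, ha, hb, hST, rfl, hi, hk, hj, (one_mul _).symm⟩
        · obtain ⟨S₁, S₂, a₁, a₂, c', q, u, h₁, h₂, hd, hu, hl', hq, hj, rfl⟩ := ihb hl hj hlj
          rw [← hu] at hST ⊢
          rw [Finset.disjoint_union_right] at hST
          refine ⟨S ∪ S₁, S₂, _, a₂, c', q, u, ha.join c h₁ hST.1 hk hl', h₂, ?_, ?_,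
            Finset.mem_union_left _ hi, Finset.mem_union_right _ hq, hj, by ring⟩
          · exact Finset.disjoint_union_left.2 ⟨hST.2, hd⟩
          · rw [Finset.union_assoc]
    rcases Finset.mem_union.1 hi with hi | hi
    · exact aux c ha hb hST hk hl iha ihb hi hj
    · obtain ⟨S₁, S₂, a₁, a₂, c', q, u, h₁, h₂, hd, hu, hi, hq, hj, he⟩ :=
        aux c hb ha hST.symm hl hk ihb iha hi (by rwa [Finset.union_comm])
      refine ⟨S₁, S₂, a₁, a₂, c', q, -u, h₁, h₂, hd, by rw [hu, Finset.union_comm], hi, hq, hj, ?_⟩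
      rw [edge_swap c l k]
      linear_combination -he

/-- Closing a cycle kills a monomial. The proof uses that Arnold's relations move the edges at `j`
away from `j` up to terms with a shorter cycle, and, up to such terms, exchange the colours of two
adjacent edges with a sign; among three consecutive edges two have the same colour. -/
theorem IsTree.edge_mul_eq_zero {S : Finset (Fin n)} {a : Alg n} (h : IsTree S a) (c : Bool)
    {i j : Fin n} (hi : i ∈ S) (hj : j ∈ S) : edge c i j * a = 0 := by
  induction hN : S.card using Nat.strong_induction_on generalizing S a c i j with
  | _ N IH =>
  by_cases hij : i = j
  · subst hij; rw [edge_self, zero_mul]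
  obtain ⟨S₁, S₂, a₁, a₂, d, q, u, h₁, h₂, hd, rfl, hi, hq, hj₂, rfl⟩ := h.split hi hj hij
  have hcard := Finset.card_union_of_disjoint hd
  have hS₂ : 0 < S₂.card := h₂.nonempty.card_pos
  suffices hmain : edge c i j * edge d q j * a₁ = 0 by linear_combination u * a₂ * hmain
  by_cases hiq : i = q
  · subst hiq; rw [edge_mul_edge, zero_mul]
  have hz : ∀ f, edge f i q * a₁ = 0 := fun f => IH _ (by omega) h₁ f hi hq rfl
  have hswap : ∀ c d, edge c i j * edge d q j * a₁ = -(edge d i j * edge c q j * a₁) := by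
    intro c d
    have := arnold c d i q j
    rw [edge_swap d i j, edge_swap c i j] at this
    linear_combination -a₁ * this + (edge d q j - edge d i j) * hz c
      + (edge c q j - edge c i j) * hz d
  have hsame : ∀ c, edge c i j * edge c q j * a₁ = 0 := by
    intro c
    have := arnold_self c i q j
    rw [edge_swap c i j] at this
    linear_combination -a₁ * this + (edge c q j - edge c i j) * hz c
  obtain ⟨T₁, T₂, b₁, b₂, f, r, s, k₁, k₂, hdT, rfl, hi', hr, hq', rfl⟩ := h₁.split hi hq hiq
  have hcardT := Finset.card_union_of_disjoint hdT
  have hT₂ : 0 < T₂.card := k₂.nonempty.card_pos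
  have hjT : j ∉ T₁ := fun hjT =>
    Finset.disjoint_left.1 hd (Finset.mem_union_left _ hjT) hj₂
  -- If the edges `qj` and `rq` have the same colour, they can be replaced by edges at `rj`.
  have key : ∀ c, edge c i j * edge f q j * (s * (b₁ * b₂ * edge f r q)) = 0 := by
    intro c
    have ht : IsTree (T₁ ∪ {j}) (b₁ * 1 * edge f r j) :=
      k₁.join f (IsTree.single j) (Finset.disjoint_singleton_right.2 hjT) hr
        (Finset.mem_singleton_self j)
    have h0 := IH _ (by
      rw [Finset.card_union_of_disjoint (Finset.disjoint_singleton_right.2 hjT),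
        Finset.card_singleton]
      omega) ht c (Finset.mem_union_left _ hi')
      (Finset.mem_union_right _ (Finset.mem_singleton_self j)) rfl
    have := arnold_self f r q j
    rw [edge_swap f r j] at this
    linear_combination edge c i j * s * b₁ * b₂ * this
      + s * b₂ * (edge f q j + edge f r q) * h0
  by_cases hcd : c = d
  · subst hcd; exact hsame c
  by_cases hfd : f = d
  · subst hfd; exact key c
  · have hfc : f = c := (by decide : ∀ c d f : Bool, ¬c = d → ¬f = d → f = c) c d f hcd hfd
    subst hfc
    rw [hswap, key, neg_zero]

theorem Part.eq_empty {w : Fin n → Alg n} {Y : Finset (Fin n)} {a : Alg n} (h : Part w Y 0 a) :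
    Y = ∅ := by
  cases h; rfl

/-- The block containing a given point can be put first. -/
theorem Part.exists_block {w : Fin n → Alg n} {Y : Finset (Fin n)} {r : ℕ} {a : Alg n}
    (h : Part w Y r a) : ∀ {z : Fin n}, z ∈ Y → ∃ D b d Y' r' a', IsTree D b ∧ d ∈ D ∧
      Disjoint D Y' ∧ Part w Y' r' a' ∧ z ∈ D ∧ D ∪ Y' = Y ∧ r' + 1 = r ∧ a = w d * b * a' := by
  induction h with
  | nil => intro z hz; simp at hz
  | @cons D Y r a b d hb hd hDY ha ih =>
    intro z hz
    by_cases hzD : z ∈ D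
    · exact ⟨D, b, d, Y, r, a, hb, hd, hDY, ha, hzD, rfl, rfl, rfl⟩
    · have hzY : z ∈ Y := (Finset.mem_union.1 hz).resolve_left hzD
      obtain ⟨D', b', d', Y', r', a', hb', hd', hDY', ha', hz', rfl, rfl, rfl⟩ := ih hzY
      rw [Finset.disjoint_union_right] at hDY
      refine ⟨D', b', d', D ∪ Y', r' + 1, w d * b * a', hb', hd', ?_,
        ha'.cons hb hd hDY.2, hz', ?_, rfl, by ring⟩
      · exact Finset.disjoint_union_right.2 ⟨hDY.1.symm, hDY'⟩
      · rw [← Finset.union_assoc, ← Finset.union_assoc, Finset.union_comm D]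

theorem Part.singletons (Y : Finset (Fin n)) : Part 1 Y Y.card 1 := by
  induction Y using Finset.induction_on with
  | empty => exact Part.nil
  | insert v Y hv ih =>
    have := ih.cons (IsTree.single v) (Finset.mem_singleton_self v)
      (Finset.disjoint_singleton_left.2 hv)
    rw [Pi.one_apply, mul_one, mul_one] at this
    rwa [Finset.card_insert_of_notMem hv, Finset.insert_eq]

/-- A monomial is zero or a forest. -/
theorem mon_eq_zero_or_part {P : Finset (Fin n)} : ∀ {l : List (Bool × Fin n × Fin n)},
    Inside P l → mon l = 0 ∨ ∃ r, Part 1 P r (mon l) ∧ l.length + r = P.card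
  | [], _ => Or.inr ⟨P.card, Part.singletons P, by simp⟩
  | (c, i, j) :: l, h => by
    have hij := h _ List.mem_cons_self
    rw [mon_cons]
    rcases mon_eq_zero_or_part (l := l) fun g hg => h g (List.mem_cons_of_mem _ hg) with h0 | h0
    · exact Or.inl (by rw [h0, mul_zero])
    obtain ⟨r, hr, hlr⟩ := h0
    obtain ⟨D, b, d, Y', r', a', hb, hd, hDY, ha, hi, rfl, rfl, he⟩ := hr.exists_block hij.1
    rcases Finset.mem_union.1 hij.2 with hj | hj
    · refine Or.inl ?_
      rw [he]
      linear_combination (1 : Fin n → Alg n) d * a' * hb.edge_mul_eq_zero c hi hj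
    · obtain ⟨D', b', d', Y'', r'', a'', hb', hd', hDY', ha', hj', rfl, rfl, rfl⟩ :=
        ha.exists_block hj
      rw [Finset.disjoint_union_right] at hDY
      have hjoin := ha'.cons (d := i) (hb.join c hb' hDY.1 hi hj') (Finset.mem_union_left _ hi)
        (Finset.disjoint_union_left.2 ⟨hDY.2, hDY'⟩)
      refine Or.inr ⟨r'' + 1, ?_, by simp at hlr ⊢; omega⟩
      rw [he, ← Finset.union_assoc]
      convert hjoin using 1
      simp only [Pi.one_apply]
      ring

/-- A monomial on a nonempty set of `p` vertices vanishes as soon as it has `p` edges. -/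
theorem mon_eq_zero {P : Finset (Fin n)} {l : List (Bool × Fin n × Fin n)} (h : Inside P l)
    (hP : P.Nonempty) (hl : P.card ≤ l.length) : mon l = 0 := by
  rcases mon_eq_zero_or_part h with h0 | ⟨r, hr, hlr⟩
  · exact h0
  · obtain rfl : r = 0 := by omega
    exact absurd hr.eq_empty hP.ne_empty

end Trees

/-! ### Straightening at a vertex -/

section Straightening

variable {n : ℕ}

/-- The edge of colour `x` from `d` to `m`. -/
def inEdge (m d : Fin n) : Alg n := edge true d m

/-- The edge of colour `y` from `m` to `d`. -/
def outEdge (m d : Fin n) : Alg n := edge false m d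

theorem Part.card_le {w : Fin n → Alg n} {Y : Finset (Fin n)} {r : ℕ} {a : Alg n}
    (h : Part w Y r a) : r ≤ Y.card := by
  induction h with
  | nil => simp
  | cons hb hd hDY ha ih =>
    rw [Finset.card_union_of_disjoint hDY]
    have := hb.nonempty.card_pos
    omega

theorem Part.mul {w : Fin n → Alg n} {Y Y' : Finset (Fin n)} {r r' : ℕ} {a a' : Alg n}
    (h : Part w Y r a) (h' : Part w Y' r' a') (hd : Disjoint Y Y') :
    Part w (Y ∪ Y') (r + r') (a * a') := by
  induction h with
  | nil => simpa using h'
  | @cons D Y r a b d hb hd' hDY ha ih =>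
    rw [Finset.disjoint_union_left] at hd
    have := (ih hd.2).cons hb hd' (Finset.disjoint_union_right.2 ⟨hDY, hd.1⟩)
    rw [Finset.union_assoc, Nat.add_right_comm, mul_assoc]
    exact this

/-- A tree can be grafted onto a family of trees. -/
theorem Part.graft {w : Fin n → Alg n} {Y S : Finset (Fin n)} {r : ℕ} {a b : Alg n} {p q : Fin n}
    (h : Part w Y r a) (hb : IsTree S b) (hd : Disjoint Y S) (c : Bool) (hp : p ∈ Y)
    (hq : q ∈ S) : Part w (Y ∪ S) r (a * b * edge c p q) := by
  obtain ⟨D, b', d, Y', r', a', hb', hd', hDY, ha, hp', rfl, rfl, rfl⟩ := h.exists_block hp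
  rw [Finset.disjoint_union_left] at hd
  have := ha.cons (hb'.join c hb hd.1 hp' hq) (Finset.mem_union_left _ hd')
    (Finset.disjoint_union_left.2 ⟨hDY, hd.2.symm⟩)
  rw [Finset.union_right_comm]
  convert this using 1
  ring

theorem IsTree.part {w : Fin n → Alg n} {S : Finset (Fin n)} {b : Alg n} {d : Fin n}
    (hb : IsTree S b) (hd : d ∈ S) : Part w S 1 (w d * b) := by
  simpa using (Part.nil (w := w)).cons hb hd (Finset.disjoint_empty_right S)

/-- The monomials obtained by joining trees on the blocks of a partition of `Y` to the vertex `m`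
so that some block is joined by an edge of colour `x`. -/
inductive Mixed (m : Fin n) (Y : Finset (Fin n)) : Alg n → Prop
  | mk {X Y' : Finset (Fin n)} {s r : ℕ} {a b : Alg n} (hd : Disjoint X Y') (hu : X ∪ Y' = Y)
      (hX : X.Nonempty) (ha : Part (inEdge m) X s a) (hb : Part (outEdge m) Y' r b) :
      Mixed m Y (a * b)

/-- The span of the monomials that are treated as lower-order terms when the family of `r` trees
on `Y`, joined to `m` by edges of colour `y`, is rewritten: families of `r + 1` trees, and
monomials with an edge of colour `x` at `m`. -/
def lower (m : Fin n) (Y : Finset (Fin n)) (r : ℕ) : Submodule ℚ (Alg n) :=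
  Submodule.span ℚ {a | Part (outEdge m) Y (r + 1) a ∨ Mixed m Y a}

theorem Part.mem_lower {m : Fin n} {Y : Finset (Fin n)} {r : ℕ} {a : Alg n}
    (h : Part (outEdge m) Y (r + 1) a) : a ∈ lower m Y r := Submodule.subset_span (Or.inl h)

theorem Mixed.mem_lower {m : Fin n} {Y : Finset (Fin n)} {r : ℕ} {a : Alg n}
    (h : Mixed m Y a) : a ∈ lower m Y r := Submodule.subset_span (Or.inr h)

theorem Part.mul_mem_lower {m : Fin n} {Y Y' : Finset (Fin n)} {r r' : ℕ} {a x : Alg n}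
    (h : Part (outEdge m) Y r a) (hx : x ∈ lower m Y' r') (hd : Disjoint Y Y') :
    a * x ∈ lower m (Y ∪ Y') (r + r') := by
  induction hx using Submodule.span_induction with
  | mem x hx =>
    rcases hx with hx | hx
    · exact (h.mul hx hd).mem_lower
    · obtain ⟨hd', rfl, hX, hu, hv⟩ := hx
      rw [Finset.disjoint_union_right] at hd
      rw [mul_left_comm]
      refine (Mixed.mk ?_ ?_ hX hu (h.mul hv hd.2)).mem_lower
      · exact Finset.disjoint_union_right.2 ⟨hd.1.symm, hd'⟩
      · rw [Finset.union_left_comm]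
  | zero => rw [mul_zero]; exact zero_mem _
  | add x y _ _ hx hy => rw [mul_add]; exact add_mem hx hy
  | smul t x _ hx => rw [mul_smul_comm]; exact Submodule.smul_mem _ _ hx

theorem graft_mem_lower {m : Fin n} {Y S : Finset (Fin n)} {r : ℕ} {x b : Alg n} {p q : Fin n}
    (hx : x ∈ lower m Y r) (hb : IsTree S b) (hd : Disjoint Y S) (c : Bool) (hp : p ∈ Y)
    (hq : q ∈ S) : x * b * edge c p q ∈ lower m (Y ∪ S) r := by
  induction hx using Submodule.span_induction with
  | mem x hx =>
    rcases hx with hx | hx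
    · exact (hx.graft hb hd c hp hq).mem_lower
    · obtain @⟨X, Y', s, r, a₁, a₂, hd', rfl, hX, hu, hv⟩ := hx
      rw [Finset.disjoint_union_left] at hd
      rcases Finset.mem_union.1 hp with hp | hp
      · have := Mixed.mk (Finset.disjoint_union_left.2 ⟨hd', hd.2.symm⟩)
          (Finset.union_right_comm _ _ _) (hX.mono Finset.subset_union_left)
          (hu.graft hb hd.1 c hp hq) hv
        convert this.mem_lower using 1
        ring
      · have := Mixed.mk (Finset.disjoint_union_right.2 ⟨hd', hd.1⟩)
          (Finset.union_assoc _ _ _).symm hX hu (hv.graft hb hd.2 c hp hq)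
        convert this.mem_lower using 1
        ring
  | zero => simp only [zero_mul]; exact zero_mem _
  | add x y _ _ hx hy => simp only [add_mul]; exact add_mem hx hy
  | smul t x _ hx => simp only [smul_mul_assoc]; exact Submodule.smul_mem _ _ hx

/-- Up to lower-order terms, it does not matter at which of its vertices a tree is joined to `m`
by an edge of colour `y`. -/
theorem IsTree.sub_mul_mem_lower {m : Fin n} {D : Finset (Fin n)} {b : Alg n} (hb : IsTree D b) :
    ∀ {d d' : Fin n}, d ∈ D → d' ∈ D → (outEdge m d - outEdge m d') * b ∈ lower m D 1 := by
  induction hb with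
  | single v =>
    intro d d' hd hd'
    rw [Finset.mem_singleton.1 hd, Finset.mem_singleton.1 hd', sub_self, zero_mul]
    exact zero_mem _
  | @join S T a b i j c ha hb hST hi hj iha ihb =>
    have hmid : (outEdge m i - outEdge m j) * (a * b * edge c i j) ∈ lower m (S ∪ T) 1 := by
      cases c
      · convert ((ha.part (w := outEdge m) hi).mul (hb.part (w := outEdge m) hj) hST).mem_lower
          using 1
        have := arnold_self false i j m
        simp only [outEdge]
        rw [edge_swap false m j] at this
        linear_combination a * b * this
      · have h₁ : inEdge m j * b * (outEdge m i * a) ∈ lower m (S ∪ T) 1 :=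
          (Mixed.mk hST.symm (Finset.union_comm _ _) hb.nonempty (hb.part hj)
            (ha.part hi)).mem_lower
        have h₂ : inEdge m i * a * (outEdge m j * b) ∈ lower m (S ∪ T) 1 :=
          (Mixed.mk hST rfl ha.nonempty (ha.part hi) (hb.part hj)).mem_lower
        have h₃ : ∀ k ∈ S ∪ T, inEdge m k * (a * b * edge false i j) * 1 ∈ lower m (S ∪ T) 1 :=
          fun k hk => (Mixed.mk (Finset.disjoint_empty_right _) (Finset.union_empty _)
            (ha.nonempty.mono Finset.subset_union_left) ((ha.join false hb hST hi hj).part hk)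
            Part.nil).mem_lower
        have h₄ := h₃ i (Finset.mem_union_left _ hi)
        have h₅ := h₃ j (Finset.mem_union_right _ hj)
        convert sub_mem (sub_mem h₄ h₅) (add_mem h₁ h₂) using 1
        have := arnold true false i j m
        simp only [outEdge, inEdge]
        rw [edge_swap false m j, edge_swap true i m] at this
        linear_combination a * b * this
    have hleft : ∀ {d d'}, d ∈ S → d' ∈ S →
        (outEdge m d - outEdge m d') * (a * b * edge c i j) ∈ lower m (S ∪ T) 1 := by
      intro d d' hd hd'
      convert graft_mem_lower (iha hd hd') hb hST c hi hj using 1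
      ring
    have hright : ∀ {d d'}, d ∈ T → d' ∈ T →
        (outEdge m d - outEdge m d') * (a * b * edge c i j) ∈ lower m (S ∪ T) 1 := by
      intro d d' hd hd'
      have := graft_mem_lower (ihb hd hd') ha hST.symm c hj hi
      rw [Finset.union_comm, edge_swap c i j] at this
      convert neg_mem this using 1
      ring
    have hto : ∀ {d}, d ∈ S ∪ T →
        (outEdge m d - outEdge m i) * (a * b * edge c i j) ∈ lower m (S ∪ T) 1 := by
      intro d hd
      rcases Finset.mem_union.1 hd with hd | hd
      · exact hleft hd hi
      · convert sub_mem (hright hd hj) hmid using 1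
        ring
    intro d d' hd hd'
    convert sub_mem (hto hd) (hto hd') using 1
    ring

/-- The span of the monomials obtained by joining trees on the blocks of a partition of `Y` to the
vertex `m`, by edges of either colour. -/
def stars (m : Fin n) (Y : Finset (Fin n)) : Submodule ℚ (Alg n) :=
  Submodule.span ℚ {x | ∃ X Y' s r a b, Disjoint X Y' ∧ X ∪ Y' = Y ∧
    Part (inEdge m) X s a ∧ Part (outEdge m) Y' r b ∧ x = a * b}

theorem graft_mem_stars {m : Fin n} {Y S : Finset (Fin n)} {x b : Alg n} {p q : Fin n}
    (hx : x ∈ stars m Y) (hb : IsTree S b) (hd : Disjoint Y S) (c : Bool) (hp : p = m ∨ p ∈ Y)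
    (hq : q ∈ S) : x * b * edge c p q ∈ stars m (Y ∪ S) := by
  induction hx using Submodule.span_induction with
  | mem x hx =>
    obtain ⟨X, Y', s, r, a₁, a₂, hd', rfl, hu, hv, rfl⟩ := hx
    rw [Finset.disjoint_union_left] at hd
    rcases hp with rfl | hp
    · cases c
      · refine Submodule.subset_span ⟨X, Y' ∪ S, s, r + 1, a₁, _,
          Finset.disjoint_union_right.2 ⟨hd', hd.1⟩, (Finset.union_assoc _ _ _).symm, hu,
          hv.mul (hb.part hq) hd.2, ?_⟩
        simp only [outEdge]
        ring
      · rw [← neg_mem_iff]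
        refine Submodule.subset_span ⟨X ∪ S, Y', s + 1, r, _, a₂,
          Finset.disjoint_union_left.2 ⟨hd', hd.2.symm⟩, Finset.union_right_comm _ _ _,
          hu.mul (hb.part hq) hd.1, hv, ?_⟩
        simp only [inEdge]
        rw [edge_swap true p q]
        ring
    rcases Finset.mem_union.1 hp with hp | hp
    · exact Submodule.subset_span ⟨X ∪ S, Y', s, r, _, a₂,
        Finset.disjoint_union_left.2 ⟨hd', hd.2.symm⟩, Finset.union_right_comm _ _ _,
        hu.graft hb hd.1 c hp hq, hv, by ring⟩
    · exact Submodule.subset_span ⟨X, Y' ∪ S, s, r, a₁, _,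
        Finset.disjoint_union_right.2 ⟨hd', hd.1⟩, (Finset.union_assoc _ _ _).symm, hu,
        hv.graft hb hd.2 c hp hq, by ring⟩
  | zero => simp only [zero_mul]; exact zero_mem _
  | add x y _ _ hx hy => simp only [add_mul]; exact add_mem hx hy
  | smul t x _ hx => simp only [smul_mul_assoc]; exact Submodule.smul_mem _ _ hx

theorem IsTree.mem_stars {m : Fin n} {S : Finset (Fin n)} {a : Alg n} (h : IsTree S a) :
    m ∈ S → a ∈ stars m (S.erase m) := by
  induction h with
  | single v =>
    intro hm
    obtain rfl := Finset.mem_singleton.1 hm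
    exact Submodule.subset_span ⟨∅, ∅, 0, 0, 1, 1, Finset.disjoint_empty_right _, by simp,
      Part.nil, Part.nil, (one_mul 1).symm⟩
  | @join S T a b i j c ha hb hST hi hj iha ihb =>
    have aux : ∀ {S T : Finset (Fin n)} {a b : Alg n} {i j : Fin n}, IsTree T b →
        Disjoint S T → i ∈ S → j ∈ T → m ∈ S → a ∈ stars m (S.erase m) →
        a * b * edge c i j ∈ stars m ((S ∪ T).erase m) := by
      intro S T a b i j hb hST hi hj hm ha
      rw [Finset.erase_union_distrib,
        Finset.erase_eq_of_notMem (Finset.disjoint_left.1 hST hm)]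
      refine graft_mem_stars ha hb (hST.mono_left (Finset.erase_subset _ _)) c ?_ hj
      by_cases him : i = m
      · exact Or.inl him
      · exact Or.inr (Finset.mem_erase.2 ⟨him, hi⟩)
    intro hm
    rcases Finset.mem_union.1 hm with hm | hm
    · exact aux hb hST hi hj hm (iha hm)
    · have := aux ha hST.symm hj hi hm (ihb hm)
      rw [Finset.union_comm, edge_swap c i j] at this
      convert neg_mem this using 1
      ring

/-- Straightening at `m`. If a submodule `Z` contains the products of an arbitrary `y`-part with at
most one tree that is joined to `m` by an edge of colour `x`, as soon as the `y`-part belongs to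
given submodules `F Y` which represent all `y`-parts up to lower-order terms, then it contains all
monomials in `stars m S`. -/
theorem stars_le {m : Fin n} {S : Finset (Fin n)} (F : Finset (Fin n) → Submodule ℚ (Alg n))
    (hF : ∀ Y ⊆ S, ∀ r b, Part (outEdge m) Y r b → b ∈ F Y ⊔ lower m Y r)
    (Z : Submodule ℚ (Alg n)) (h₀ : F S ≤ Z)
    (h₁ : ∀ X ⊆ S, ∀ a, ∀ d ∈ X, IsTree X a → ∀ b ∈ F (S \ X), inEdge m d * a * b ∈ Z) :
    stars m S ≤ Z := by
  -- Each rewriting step enlarges the part joined by `x`-edges, or keeps it and lowers the number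
  -- of these edges, or keeps both and raises the number of `y`-edges at `m`.
  have key : ∀ N k q, ∀ X Y s r a b, Disjoint X Y → X ∪ Y = S → Part (inEdge m) X s a →
      Part (outEdge m) Y r b → Y.card = N → s = k → Y.card - r = q → a * b ∈ Z := by
    intro N
    induction N using Nat.strong_induction_on with
    | _ N IHN =>
    intro k
    induction k using Nat.strong_induction_on with
    | _ k IHk =>
    intro q
    induction q using Nat.strong_induction_on with
    | _ q IHq =>
    intro X Y s r a b hd hu ha hb hN hk hq
    have hYS : Y ⊆ S := hu ▸ Finset.subset_union_right
    have hXS : X ⊆ S := hu ▸ Finset.subset_union_left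
    have hSX : S \ X = Y := by
      rw [← hu, Finset.union_sdiff_cancel_left hd]
    have hlow : ∀ x ∈ lower m Y r, a * x ∈ Z := by
      intro x hx
      induction hx using Submodule.span_induction with
      | mem x hx =>
        rcases hx with hx | hx
        · have := hx.card_le
          exact IHq (Y.card - (r + 1)) (by omega) X Y s (r + 1) a x hd hu ha hx hN hk rfl
        · obtain @⟨X', Y', s', r', a', b', hd', rfl, hX', ha', hb'⟩ := hx
          rw [Finset.disjoint_union_right] at hd
          have hc := Finset.card_union_of_disjoint hd'
          have := hX'.card_pos
          rw [← mul_assoc]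
          exact IHN Y'.card (by omega) (s + s') (Y'.card - r') (X ∪ X') Y' (s + s') r' _ b'
            (Finset.disjoint_union_left.2 ⟨hd.2, hd'⟩) (by rw [Finset.union_assoc, hu])
            (ha.mul ha' hd.1) hb' rfl rfl rfl
      | zero => rw [mul_zero]; exact zero_mem _
      | add x y _ _ hx hy => rw [mul_add]; exact add_mem hx hy
      | smul t x _ hx => rw [mul_smul_comm]; exact Submodule.smul_mem _ _ hx
    obtain ⟨f, hf, x, hx, rfl⟩ := Submodule.mem_sup.1 (hF Y hYS r b hb)
    rw [mul_add]
    refine add_mem ?_ (hlow x hx)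
    cases ha with
    | nil =>
      rw [Finset.sdiff_empty] at hSX
      rw [one_mul]
      exact h₀ (hSX ▸ hf)
    | @cons D X' s' a' b' d hb' hd' hDX ha' =>
      cases ha' with
      | nil =>
        rw [Finset.union_empty] at hXS hSX
        rw [mul_one]
        exact h₁ D hXS b' d hd' hb' f (hSX ▸ hf)
      | @cons D₂ X₂ s₂ a₂ b₂ d₂ hb₂ hd₂ hDX₂ ha₂ =>
        -- Two edges of colour `x` at `m` are merged by Arnold's relation.
        rw [Finset.disjoint_union_right] at hDX
        have hm : ∀ e ∈ D ∪ D₂, inEdge m e * (b' * b₂ * edge true d d₂) * a₂ * (f + x) ∈ Z := by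
          intro e he
          have hp := ha₂.cons (hb'.join true hb₂ hDX.1 hd' hd₂) he
            (Finset.disjoint_union_left.2 ⟨hDX.2, hDX₂⟩)
          rw [Finset.union_assoc] at hp
          exact IHk (s₂ + 1) (by omega) _ _ Y (s₂ + 1) r _ (f + x) hd hu hp hb hN rfl rfl
        have h1 := sub_mem (sub_mem (hm d₂ (Finset.mem_union_right _ hd₂))
          (hm d (Finset.mem_union_left _ hd'))) (hlow x hx)
        convert h1 using 1
        have := arnold_self true d d₂ m
        rw [edge_swap true d m] at this
        simp only [inEdge]
        linear_combination -(b' * b₂ * a₂ * (f + x)) * this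
  refine Submodule.span_le.2 ?_
  rintro x ⟨X, Y', s, r, a, b, hd, hu, ha, hb, rfl⟩
  exact key _ _ _ X Y' s r a b hd hu ha hb rfl rfl rfl

end Straightening

/-! ### Contractions -/

section Contractions

variable {n : ℕ}

/-- The list of edges obtained by applying `f` to the vertices. -/
def relabel (f : Fin n → Fin n) (l : List (Bool × Fin n × Fin n)) : List (Bool × Fin n × Fin n) :=
  l.map fun g => (g.1, f g.2.1, f g.2.2)

theorem mon_filter (p : Bool × Fin n × Fin n → Prop) [DecidablePred p]
    (l : List (Bool × Fin n × Fin n)) :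
    mon l = mon (l.filter fun g => ¬p g) * mon (l.filter fun g => p g) := by
  induction l with
  | nil => simp [mon_nil]
  | cons g l ih =>
    by_cases hg : p g
    · simp only [hg, List.filter_cons, mon_cons, decide_true, not_true, decide_false, if_true, ih,
        Bool.false_eq_true, if_false]
      ring
    · simp only [hg, List.filter_cons, mon_cons, decide_true, not_false_iff, decide_false, if_true,
        ih, Bool.false_eq_true, if_false]
      ring

theorem length_filter (p : Bool × Fin n × Fin n → Prop) [DecidablePred p]
    (l : List (Bool × Fin n × Fin n)) :
    (l.filter fun g => ¬p g).length + (l.filter fun g => p g).length = l.length := by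
  induction l with
  | nil => simp
  | cons g l ih =>
    by_cases hg : p g <;> simp [hg] at ih ⊢ <;> omega

/-- The contraction operators from `S` to `r`. Such an operator depends only on its restriction to
the monomials with all edges inside `S`, on which it takes scalar values and vanishes unless the
number of edges is that of a spanning tree; all other edges pass through it with the points of `S`
identified with `r`. -/
structure IsContr (S : Finset (Fin n)) (r : Fin n) (G : Alg n →ₗ[ℚ] Alg n) : Prop where
  out : ∀ c i j p, ¬(i ∈ S ∧ j ∈ S) →
    G (edge c i j * p) = edge c (collapse S r i) (collapse S r j) * G p
  inn : ∀ l, Inside S l → ∃ k : ℚ, G (mon l) = algebraMap ℚ (Alg n) k ∧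
    (l.length + 1 ≠ S.card → k = 0)

theorem IsContr.mon_mul {S : Finset (Fin n)} {r : Fin n} {G : Alg n →ₗ[ℚ] Alg n}
    (hG : IsContr S r G) {l : List (Bool × Fin n × Fin n)} (p : Alg n)
    (hl : ∀ g ∈ l, ¬(g.2.1 ∈ S ∧ g.2.2 ∈ S)) :
    G (mon l * p) = mon (relabel (collapse S r) l) * G p := by
  induction l with
  | nil => simp [mon_nil, relabel]
  | cons g l ih =>
    rw [mon_cons, mul_assoc, hG.out _ _ _ _ (hl g List.mem_cons_self),
      ih fun g hg => hl g (List.mem_cons_of_mem _ hg), ← mul_assoc]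
    exact congrArg (· * G p)
      (mon_cons (g.1, collapse S r g.2.1, collapse S r g.2.2) _).symm

/-- Monomials that meet `S` at most in `r` pass unchanged through a contraction. -/
theorem IsContr.pull {S T : Finset (Fin n)} {r : Fin n} {G : Alg n →ₗ[ℚ] Alg n}
    (hG : IsContr S r G) {l : List (Bool × Fin n × Fin n)} (hl : Inside T l)
    (hT : ∀ v ∈ T, v ∈ S → v = r) (p : Alg n) : G (mon l * p) = mon l * G p := by
  induction l with
  | nil => simp [mon_nil]
  | cons g l ih =>
    obtain ⟨c, i, j⟩ := g
    have hg : i ∈ T ∧ j ∈ T := hl _ List.mem_cons_self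
    have hcol : ∀ v ∈ T, collapse S r v = v := fun v hv => by
      by_cases h : v ∈ S
      · rw [collapse, if_pos h, hT v hv h]
      · rw [collapse, if_neg h]
    rw [mon_cons, mul_assoc, mul_assoc]
    by_cases h : i ∈ S ∧ j ∈ S
    · simp [hT i hg.1 h.1, hT j hg.2 h.2, edge_self]
    · simp only
      rw [hG.out c i j _ h, hcol i hg.1, hcol j hg.2,
        ih fun g hg => hl g (List.mem_cons_of_mem _ hg)]

theorem IsContr.scalar {S : Finset (Fin n)} {r : Fin n} {G : Alg n →ₗ[ℚ] Alg n}
    (hG : IsContr S r G) {l : List (Bool × Fin n × Fin n)} (hl : Inside S l) :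
    G (mon l) = algebraMap ℚ (Alg n) (aug n (G (mon l))) := by
  obtain ⟨k, hk, -⟩ := hG.inn l hl
  rw [hk, AlgHom.commutes]
  rfl

theorem isContr_id (r : Fin n) : IsContr {r} r LinearMap.id where
  out c i j p h := by
    have hcol : ∀ v, collapse {r} r v = v := fun v => by
      simp only [collapse, Finset.mem_singleton]
      split_ifs with hv
      · exact hv.symm
      · rfl
    simp [hcol]
  inn l hl := by
    cases l with
    | nil => exact ⟨1, by simp [mon_nil], by simp⟩
    | cons g l =>
      have hg := hl g List.mem_cons_self
      rw [Finset.mem_singleton, Finset.mem_singleton] at hg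
      exact ⟨0, by simp [mon_cons, hg.1, hg.2, edge_self], fun _ => rfl⟩

theorem isContr_residue (c : Bool) {i j : Fin n} (hij : i ≠ j) :
    IsContr {i, j} i (residue c i j) where
  out d k l p h := by
    rw [residue_mul, residue_edge, coeffEdge_eq_zero h, zero_mul, add_zero, mapHom_edge]
  inn l hl := by
    match l, hl with
    | [], _ => exact ⟨0, by simp [mon_nil, residue_one], fun _ => rfl⟩
    | [g], _ =>
      refine ⟨if g.1 = c then (if g.2.1 = i ∧ g.2.2 = j then 1 else 0)
        - (if g.2.1 = j ∧ g.2.2 = i then 1 else 0) else 0, ?_, fun h => ?_⟩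
      · rw [mon_cons, mon_nil, mul_one, residue_edge, coeffEdge]
        split_ifs <;> simp
      · rw [Finset.card_pair hij] at h
        exact absurd rfl h
    | g :: g' :: l, hl =>
      refine ⟨0, ?_, fun _ => rfl⟩
      rw [mon_eq_zero hl (Finset.insert_nonempty _ _) (by rw [Finset.card_pair hij]; simp),
        map_zero, map_zero]

theorem IsContr.comp {S T : Finset (Fin n)} {r t : Fin n} {G H : Alg n →ₗ[ℚ] Alg n}
    (hG : IsContr S r G) (hH : IsContr T t H) (hST : S ∩ T = {r}) :
    IsContr (S ∪ T) t (H ∘ₗ G) := by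
  have hr : r ∈ S ∧ r ∈ T := Finset.mem_inter.1 (hST ▸ Finset.mem_singleton_self r)
  have hmem : ∀ v, collapse S r v ∈ T ↔ v ∈ S ∪ T := by
    intro v
    rw [Finset.mem_union, collapse]
    split_ifs with h
    · simp [h, hr.2]
    · simp [h]
  have hcol : ∀ v, collapse T t (collapse S r v) = collapse (S ∪ T) t v := by
    intro v
    change (if collapse S r v ∈ T then t else collapse S r v) = if v ∈ S ∪ T then t else v
    rw [if_congr (hmem v) rfl rfl]
    split_ifs with h
    · rfl
    · rw [collapse, if_neg fun hv => h (Finset.mem_union_left _ hv)]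
  refine ⟨fun c i j p h => ?_, fun l hl => ?_⟩
  · have h₁ : ¬(i ∈ S ∧ j ∈ S) := fun h' =>
      h ⟨Finset.mem_union_left _ h'.1, Finset.mem_union_left _ h'.2⟩
    rw [LinearMap.comp_apply, hG.out c i j p h₁, hH.out _ _ _ _ (by rwa [hmem, hmem]), hcol, hcol]
    rfl
  · let P : Bool × Fin n × Fin n → Prop := fun g => g.2.1 ∈ S ∧ g.2.2 ∈ S
    have hin : Inside S (l.filter fun g => P g) := fun g hg => by
      simpa only [P, decide_eq_true_eq] using (List.mem_filter.1 hg).2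
    obtain ⟨k, hk, hk0⟩ := hG.inn _ hin
    obtain ⟨k', hk', hk0'⟩ := hH.inn (relabel (collapse S r) (l.filter fun g => ¬P g)) (by
      intro g hg
      obtain ⟨g', hg', rfl⟩ := List.mem_map.1 hg
      have := hl g' (List.mem_filter.1 hg').1
      exact ⟨(hmem _).2 this.1, (hmem _).2 this.2⟩)
    refine ⟨k * k', ?_, fun hc => ?_⟩
    · rw [mon_filter P l, LinearMap.comp_apply, hG.mon_mul _ fun g hg => by
        simpa only [P, decide_eq_true_eq] using (List.mem_filter.1 hg).2, hk, mul_comm,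
        ← Algebra.smul_def, map_smul, hk',
        Algebra.smul_def, map_mul]
    · have h1 := length_filter P l
      have h2 := Finset.card_union_add_card_inter S T
      rw [hST, Finset.card_singleton] at h2
      rw [relabel, List.length_map] at hk0'
      by_contra hne
      have h3 : _ = S.card := not_not.1 fun h => hne (by rw [hk0 h, zero_mul])
      have h4 : _ = T.card := not_not.1 fun h => hne (by rw [hk0' h, mul_zero])
      omega

/-- A contraction kills the monomials whose restriction to `K` is disconnected: they have too few
edges inside `K`. -/
theorem IsContr.mon_mul_mon_eq_zero {K P P' : Finset (Fin n)} {r : Fin n} {G : Alg n →ₗ[ℚ] Alg n}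
    (hG : IsContr K r G) (hd : Disjoint P P') (hK : K ⊆ P ∪ P') (hP : (K ∩ P).Nonempty)
    (hP' : (K ∩ P').Nonempty) {l l' : List (Bool × Fin n × Fin n)} (hl : Inside P l)
    (hl' : Inside P' l') : G (mon l * mon l') = 0 := by
  let Q : Bool × Fin n × Fin n → Prop := fun g => g.2.1 ∈ K ∧ g.2.2 ∈ K
  have hin : ∀ {P l}, Inside P l → Inside (K ∩ P) (l.filter fun g => Q g) := fun {P l} hl g hg => by
    have h1 : Q g := by simpa using (List.mem_filter.1 hg).2
    have h2 := hl g (List.mem_filter.1 hg).1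
    exact ⟨Finset.mem_inter.2 ⟨h1.1, h2.1⟩, Finset.mem_inter.2 ⟨h1.2, h2.2⟩⟩
  have hout : ∀ {l : List (Bool × Fin n × Fin n)}, ∀ g ∈ l.filter fun g => ¬Q g,
      ¬(g.2.1 ∈ K ∧ g.2.2 ∈ K) := fun {l} g hg => by
    simpa only [Q, decide_eq_true_eq] using (List.mem_filter.1 hg).2
  have hcard : (K ∩ P).card + (K ∩ P').card = K.card := by
    rw [← Finset.card_union_of_disjoint
      (hd.mono Finset.inter_subset_right Finset.inter_subset_right),
      ← Finset.inter_union_distrib_left, Finset.inter_eq_left.2 hK]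
  have hre : mon l * mon l' = mon (l.filter fun g => ¬Q g) * (mon (l'.filter fun g => ¬Q g) *
      (mon (l.filter fun g => Q g) * mon (l'.filter fun g => Q g))) := by
    rw [mon_filter Q l, mon_filter Q l']
    ring
  rw [hre, hG.mon_mul _ hout, hG.mon_mul _ hout]
  suffices G (mon (l.filter fun g => Q g) * mon (l'.filter fun g => Q g)) = 0 by
    rw [this, mul_zero, mul_zero]
  by_cases h1 : (K ∩ P).card ≤ (l.filter fun g => Q g).length
  · rw [mon_eq_zero (hin hl) hP h1, zero_mul, map_zero]
  by_cases h2 : (K ∩ P').card ≤ (l'.filter fun g => Q g).length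
  · rw [mon_eq_zero (hin hl') hP' h2, mul_zero, map_zero]
  rw [← mon_append]
  obtain ⟨k, hk, hk0⟩ := hG.inn _ (((hin hl).mono Finset.inter_subset_left).append
    ((hin hl').mono Finset.inter_subset_left))
  rw [hk, hk0 (by rw [List.length_append]; omega), map_zero]

/-- If a tree on `B'` is contracted along a proper subset `B`, then an edge at the image `r` of `B`
is left. -/
theorem IsContr.exists_edge {B B' : Finset (Fin n)} {r : Fin n} {G : Alg n →ₗ[ℚ] Alg n}
    (hG : IsContr B r G) (hB : B.Nonempty) (hBB' : B ⊂ B') {l : List (Bool × Fin n × Fin n)}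
    (hl : Inside B' l) (hlen : l.length + 1 = B'.card) :
    ∃ c, ∃ z ∈ B' \ B, ∃ p, G (mon l) = edge c r z * p := by
  let Q : Bool × Fin n × Fin n → Prop := fun g => g.2.1 ∈ B ∧ g.2.2 ∈ B
  have hin : Inside B (l.filter fun g => Q g) := fun g hg => by
    simpa only [Q, decide_eq_true_eq] using (List.mem_filter.1 hg).2
  have hout : ∀ g ∈ l.filter fun g => ¬Q g, ¬(g.2.1 ∈ B ∧ g.2.2 ∈ B) := fun g hg => by
    simpa only [Q, decide_eq_true_eq] using (List.mem_filter.1 hg).2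
  have hout' : Inside B' (l.filter fun g => ¬Q g) := fun g hg => hl g (List.mem_filter.1 hg).1
  obtain ⟨z₀, hz₀⟩ : (B' \ B).Nonempty := Finset.sdiff_nonempty.2 hBB'.2
  have hcard := Finset.card_sdiff_add_card_eq_card hBB'.1
  rw [mon_filter Q l]
  by_cases h : ∃ g ∈ l.filter fun g => ¬Q g, g.2.1 ∈ B ∨ g.2.2 ∈ B
  · obtain ⟨⟨c, i, j⟩, hg, hij⟩ := h
    obtain ⟨l₁, l₂, hl₁₂⟩ := List.append_of_mem hg
    rw [hG.mon_mul _ hout, hl₁₂, relabel, List.map_append, List.map_cons, mon_append, mon_cons]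
    have hn : ¬(i ∈ B ∧ j ∈ B) := hout _ hg
    have hm : i ∈ B' ∧ j ∈ B' := hout' _ hg
    by_cases hi : i ∈ B
    · have hj : j ∉ B := fun hj => hn ⟨hi, hj⟩
      refine ⟨c, j, Finset.mem_sdiff.2 ⟨hm.2, hj⟩, mon (l₁.map fun g => (g.1,
        collapse B r g.2.1, collapse B r g.2.2)) * mon (l₂.map fun g => (g.1,
        collapse B r g.2.1, collapse B r g.2.2)) * G (mon (l.filter fun g => Q g)), ?_⟩
      simp only [collapse, if_pos hi, if_neg hj]
      ring
    · have hj : j ∈ B := hij.resolve_left hi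
      refine ⟨c, i, Finset.mem_sdiff.2 ⟨hm.1, hi⟩, -(mon (l₁.map fun g => (g.1,
        collapse B r g.2.1, collapse B r g.2.2)) * mon (l₂.map fun g => (g.1,
        collapse B r g.2.1, collapse B r g.2.2)) * G (mon (l.filter fun g => Q g))), ?_⟩
      simp only [collapse, if_neg hi, if_pos hj]
      rw [edge_swap c r i]
      ring
  · refine ⟨true, z₀, hz₀, 0, ?_⟩
    have hout'' : Inside (B' \ B) (l.filter fun g => ¬Q g) := fun g hg =>
      ⟨Finset.mem_sdiff.2 ⟨(hout' g hg).1, fun hB => h ⟨g, hg, Or.inl hB⟩⟩,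
        Finset.mem_sdiff.2 ⟨(hout' g hg).2, fun hB => h ⟨g, hg, Or.inr hB⟩⟩⟩
    have hlen' := length_filter Q l
    rw [mul_zero]
    by_cases h1 : (B' \ B).card ≤ (l.filter fun g => ¬Q g).length
    · rw [mon_eq_zero hout'' ⟨z₀, hz₀⟩ h1, zero_mul, map_zero]
    · rw [mon_eq_zero hin hB (by omega), mul_zero, map_zero]

/-- The ideal generated by the edges at `m`. -/
def edgeIdeal (m : Fin n) : Ideal (Alg n) := Ideal.span {a | ∃ c z, a = edge c m z}

theorem edge_mem_edgeIdeal (c : Bool) (m z : Fin n) : edge c m z ∈ edgeIdeal m :=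
  Ideal.subset_span ⟨c, z, rfl⟩

theorem aug_eq_zero_of_mem {m : Fin n} {a : Alg n} (ha : a ∈ edgeIdeal m) : aug n a = 0 := by
  have : edgeIdeal m ≤ RingHom.ker (aug n) := Ideal.span_le.2 fun a ⟨c, z, hz⟩ => by
    rw [hz, SetLike.mem_coe, RingHom.mem_ker, aug_edge]
  exact this ha

theorem IsContr.map_mem_pow {S : Finset (Fin n)} {r m : Fin n} {G : Alg n →ₗ[ℚ] Alg n}
    (hG : IsContr S r G) (hm : m ∉ S) {k : ℕ} : ∀ {x : Alg n}, x ∈ edgeIdeal m ^ k →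
    G x ∈ edgeIdeal m ^ k := by
  induction k with
  | zero => simp
  | succ k ih =>
    intro x hx
    rw [pow_succ'] at hx ⊢
    refine Submodule.mul_induction_on hx (fun a ha b hb => ?_) fun a b ha hb => ?_
    · induction ha using Submodule.span_induction generalizing b with
      | mem a ha =>
        obtain ⟨c, z, rfl⟩ := ha
        rw [hG.out c m z b fun h => hm h.1, collapse, if_neg hm]
        exact Ideal.mul_mem_mul (edge_mem_edgeIdeal _ _ _) (ih hb)
      | zero => simp
      | add a a' _ _ ha ha' => rw [add_mul, map_add]; exact add_mem (ha b hb) (ha' b hb)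
      | smul t a _ ha =>
        rw [smul_eq_mul, mul_comm t a, mul_assoc]
        exact ha (t * b) (Ideal.mul_mem_left _ _ hb)
    · rw [map_add]
      exact add_mem ha hb

theorem residue_mem_pow (c : Bool) (m s : Fin n) {k : ℕ} : ∀ {x : Alg n},
    x ∈ edgeIdeal m ^ (k + 1) → residue c m s x ∈ edgeIdeal m ^ k := by
  have hmap : edgeIdeal m ≤ (edgeIdeal m).comap (mapHom (collapse {m, s} m)) :=
    Ideal.span_le.2 fun a ⟨d, z, hz⟩ => by
      rw [hz, SetLike.mem_coe, Ideal.mem_comap, mapHom_edge, collapse,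
        if_pos (Finset.mem_insert_self _ _)]
      exact edge_mem_edgeIdeal _ _ _
  induction k with
  | zero => simp
  | succ k ih =>
    intro x hx
    rw [pow_succ'] at hx
    refine Submodule.mul_induction_on hx (fun a ha b hb => ?_) fun a b ha hb => ?_
    · rw [residue_mul]
      refine add_mem ?_ (Ideal.mul_mem_left _ _ ?_)
      · rw [pow_succ']
        exact Ideal.mul_mem_mul (hmap ha) (ih hb)
      · exact (Ideal.pow_right_mono hmap (k + 1)).trans (Ideal.le_comap_pow _ _) hb
    · rw [map_add]
      exact add_mem ha hb

end Contractions

/-! ### Enumeration of rooted forests -/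

section Enumeration

variable {R : Type*} [CommRing R]

/-- The polynomial `∏ₖ (z + k u + (m + 1 - k) v)`, with `k` from `1` to `m`. For `z = 0` it counts
rooted trees on `m + 1` vertices by the colours of their edges. -/
def shiftProd (u v : R) (m : ℕ) (z : R) : R :=
  ∏ k ∈ Finset.range m, (z + ((k : R) + 1) * u + ((m : R) - k) * v)

/-- The polynomial `z ∏ₖ (z + k u + (m - k) v)`, with `k` from `1` to `m - 1`, which counts rooted
forests on `m` vertices, with weight `z` for each tree. -/
def forestPoly (u v : R) : ℕ → R → R
  | 0, _ => 1
  | m + 1, z => z * shiftProd u v m z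

theorem forestPoly_zero_left (u v z : R) : forestPoly u v 0 z = 1 := rfl

theorem shiftProd_sub (u v : R) (m : ℕ) (z : R) :
    shiftProd u v (m + 1) z - shiftProd u v (m + 1) (z - (u - v)) =
      (u - v) * ((m : R) + 1) * shiftProd u v m (z + v) := by
  have h : shiftProd u v m (z + v) =
      ∏ k ∈ Finset.range m, (z + ((k : R) + 1) * u + ((m : R) + 1 - k) * v) :=
    Finset.prod_congr rfl fun k _ => by ring
  have h₁ : shiftProd u v (m + 1) z =
      shiftProd u v m (z + v) * (z + ((m : R) + 1) * u + v) := by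
    rw [h, shiftProd, Finset.prod_range_succ]
    push_cast
    ring
  have h₂ : shiftProd u v (m + 1) (z - (u - v)) =
      shiftProd u v m (z + v) * (z + ((m : R) + 2) * v) := by
    rw [h, shiftProd, Finset.prod_range_succ']
    push_cast
    congr 1
    · exact Finset.prod_congr rfl fun k _ => by ring
    · ring
  rw [h₁, h₂]
  ring

theorem forestPoly_sub (u v : R) (m : ℕ) (z : R) :
    forestPoly u v (m + 1) z - forestPoly u v (m + 1) (z - (u - v)) =
      (u - v) * ((m : R) + 1) * forestPoly u v m (z + v) := by
  cases m with
  | zero => simp [forestPoly, shiftProd]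
  | succ m =>
    have h : shiftProd u v m (z + v) =
        ∏ k ∈ Finset.range m, (z + ((k : R) + 1) * u + ((m : R) + 1 - k) * v) :=
      Finset.prod_congr rfl fun k _ => by ring
    have h₁ : shiftProd u v (m + 1) z =
        shiftProd u v m (z + v) * (z + ((m : R) + 1) * u + v) := by
      rw [h, shiftProd, Finset.prod_range_succ]
      push_cast
      ring
    have h₂ := shiftProd_sub u v m z
    simp only [forestPoly]
    push_cast
    linear_combination (u - v) * h₁ + (z - (u - v)) * h₂

theorem forestPoly_zero (u v : R) (m : ℕ) : forestPoly u v m 0 = if m = 0 then 1 else 0 := by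
  cases m <;> simp [forestPoly]

/-- A function given by a polynomial is constant if it is invariant under a nonzero shift. -/
theorem eval_eq_of_shift [IsDomain R] [CharZero R] {δ : R} (hδ : δ ≠ 0) (p : Polynomial R)
    (hp : ∀ z, p.eval z = p.eval (z - δ)) (h0 : p.eval 0 = 0) : p = 0 := by
  have hk : ∀ k : ℕ, p.eval (k * δ) = 0 := by
    intro k
    induction k with
    | zero => simpa using h0
    | succ k ih => rw [hp, ← ih]; push_cast; congr 1; ring
  refine Polynomial.eq_zero_of_infinite_isRoot p (Set.infinite_of_injective_forall_mem
    (f := fun k : ℕ => (k : R) * δ) (fun a b hab => ?_) hk)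
  exact Nat.cast_injective (mul_right_cancel₀ hδ hab)

theorem exists_shiftProd_poly (u v : R) (m : ℕ) :
    ∃ p : Polynomial R, ∀ z, p.eval z = shiftProd u v m z :=
  ⟨∏ k ∈ Finset.range m, (Polynomial.X + Polynomial.C (((k : R) + 1) * u)
    + Polynomial.C (((m : R) - k) * v)), fun z => by
      simp only [Polynomial.eval_prod, Polynomial.eval_add, Polynomial.eval_X, Polynomial.eval_C,
        shiftProd]⟩

theorem exists_forestPoly_poly (u v : R) (m : ℕ) :
    ∃ p : Polynomial R, ∀ z, p.eval z = forestPoly u v m z := by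
  cases m with
  | zero => exact ⟨1, fun z => by simp [forestPoly]⟩
  | succ m =>
    obtain ⟨p, hp⟩ := exists_shiftProd_poly u v m
    exact ⟨Polynomial.X * p, fun z => by simp [forestPoly, hp]⟩

/-- Both sides have the same differences for the shift by `u - v`, by induction, and the same value
at `0`. -/
theorem sum_choose_mul_forestPoly [IsDomain R] [CharZero R] {u v : R} (huv : u ≠ v) (m : ℕ) :
    ∀ z, ∑ j ∈ Finset.range (m + 1), (m.choose j : R) * (shiftProd u v j 0 *
      forestPoly u v (m - j) z) = shiftProd u v m z := by
  induction m with
  | zero => simp [shiftProd, forestPoly]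
  | succ m ih =>
    choose p hp using exists_shiftProd_poly u v
    choose q hq using exists_forestPoly_poly u v
    have key : (∑ j ∈ Finset.range (m + 2), Polynomial.C ((m + 1).choose j : R) *
        (Polynomial.C (shiftProd u v j 0) * q (m + 1 - j))) - p (m + 1) = 0 := by
      refine eval_eq_of_shift (sub_ne_zero.2 huv) _ (fun z => ?_) ?_
      · simp only [Polynomial.eval_sub, Polynomial.eval_finsetSum, Polynomial.eval_mul,
          Polynomial.eval_C, hp, hq]
        have h₁ : ∑ j ∈ Finset.range (m + 2), ((m + 1).choose j : R) * (shiftProd u v j 0 *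
            forestPoly u v (m + 1 - j) z) - ∑ j ∈ Finset.range (m + 2), ((m + 1).choose j : R) *
              (shiftProd u v j 0 * forestPoly u v (m + 1 - j) (z - (u - v))) =
            (u - v) * ((m : R) + 1) * ∑ j ∈ Finset.range (m + 1), (m.choose j : R) *
              (shiftProd u v j 0 * forestPoly u v (m - j) (z + v)) := by
          rw [← Finset.sum_sub_distrib, Finset.sum_range_succ, Finset.mul_sum]
          simp only [Nat.sub_self, forestPoly_zero_left, sub_self, add_zero]
          refine Finset.sum_congr rfl fun j hj => ?_
          have hj' : j ≤ m := Nat.lt_succ_iff.1 (Finset.mem_range.1 hj)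
          have hs := forestPoly_sub u v (m - j) z
          rw [Nat.sub_add_comm hj']
          have hc : ((m + 1).choose j : R) * ((m - j : ℕ) + 1 : R) =
              ((m : R) + 1) * m.choose j := by
            have := Nat.choose_mul_succ_eq m j
            rw [Nat.sub_add_comm hj'] at this
            exact_mod_cast this.symm.trans (mul_comm _ _)
          linear_combination ((m + 1).choose j : R) * shiftProd u v j 0 * hs
            + shiftProd u v j 0 * (u - v) * forestPoly u v (m - j) (z + v) * hc
        rw [ih] at h₁
        linear_combination h₁ - shiftProd_sub u v m z
      · simp only [Polynomial.eval_sub, Polynomial.eval_finsetSum, Polynomial.eval_mul,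
          Polynomial.eval_C, hp, hq, forestPoly_zero]
        rw [Finset.sum_range_succ, Finset.sum_eq_zero fun j hj => ?_]
        · simp
        · have := Finset.mem_range.1 hj
          rw [if_neg (by omega), mul_zero, mul_zero]
    intro z
    have := congrArg (Polynomial.eval z) key
    simp only [Polynomial.eval_sub, Polynomial.eval_finsetSum, Polynomial.eval_mul,
      Polynomial.eval_C, hp, hq, Polynomial.eval_zero] at this
    exact sub_eq_zero.1 this

variable {α : Type*} [DecidableEq α]

/-- The recursion for forests, by the vertex set `insert z B` of the tree containing a given
vertex `z`, where `D` is the set of all other vertices. -/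
theorem sum_powerset_forestPoly [IsDomain R] [CharZero R] {u v : R} (huv : u ≠ v) (D : Finset α)
    (z : R) : ∑ B ∈ D.powerset, z * (shiftProd u v B.card 0 * forestPoly u v (D \ B).card z) =
      forestPoly u v (D.card + 1) z := by
  have h : ∀ B ∈ D.powerset, z * (shiftProd u v B.card 0 * forestPoly u v (D \ B).card z) =
      (fun j => z * (shiftProd u v j 0 * forestPoly u v (D.card - j) z)) B.card := fun B hB => by
    rw [Finset.card_sdiff_of_subset (Finset.mem_powerset.1 hB)]
  rw [Finset.sum_congr rfl h, Finset.sum_powerset_apply_card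
    (fun j => z * (shiftProd u v j 0 * forestPoly u v (D.card - j) z)), forestPoly,
    ← sum_choose_mul_forestPoly huv, Finset.mul_sum]
  refine Finset.sum_congr rfl fun j _ => ?_
  rw [nsmul_eq_mul]
  ring

/-- The recursion for trees with vertex set the disjoint union of `D` and one more vertex `m`, by
the set `C` of the vertices that are joined to `m` by an `x`-edge. -/
theorem sum_powerset_shiftProd [IsDomain R] [CharZero R] {u v : R} (huv : u ≠ v) (D : Finset α) :
    forestPoly u v D.card v + ∑ C ∈ D.powerset, (C.card : R) * u *
      (shiftProd u v (C.card - 1) 0 * forestPoly u v (D \ C).card v) =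
        shiftProd u v D.card 0 := by
  have h : ∀ C ∈ D.powerset, (C.card : R) * u *
      (shiftProd u v (C.card - 1) 0 * forestPoly u v (D \ C).card v) =
      (fun j : ℕ => (j : R) * u * (shiftProd u v (j - 1) 0 * forestPoly u v (D.card - j) v))
        C.card := fun B hB => by
    rw [Finset.card_sdiff_of_subset (Finset.mem_powerset.1 hB)]
  rw [Finset.sum_congr rfl h, Finset.sum_powerset_apply_card
    (fun j : ℕ => (j : R) * u * (shiftProd u v (j - 1) 0 * forestPoly u v (D.card - j) v))]
  obtain hc | ⟨m, hc⟩ : D.card = 0 ∨ ∃ m, D.card = m + 1 := by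
    cases D.card <;> simp
  · simp [hc, forestPoly, shiftProd]
  · rw [hc, Finset.sum_range_succ']
    have h₁ : ∀ j ∈ Finset.range (m + 1), (m + 1).choose (j + 1) • (((j + 1 : ℕ) : R) * u *
        (shiftProd u v (j + 1 - 1) 0 * forestPoly u v (m + 1 - (j + 1)) v)) =
        ((m : R) + 1) * u * ((m.choose j : R) * (shiftProd u v j 0 *
          forestPoly u v (m - j) v)) := fun j _ => by
      have : ((m + 1).choose (j + 1) : R) * ((j : R) + 1) = ((m : R) + 1) * m.choose j := by
        exact_mod_cast (Nat.add_one_mul_choose_eq m j).symm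
      rw [nsmul_eq_mul, Nat.add_sub_cancel, Nat.add_sub_add_right]
      push_cast
      linear_combination u * (shiftProd u v j 0 * forestPoly u v (m - j) v) * this
    rw [Finset.sum_congr rfl h₁, ← Finset.mul_sum, sum_choose_mul_forestPoly huv]
    have h₂ : shiftProd u v (m + 1) 0 = shiftProd u v m v * (((m : R) + 1) * u + v) := by
      rw [shiftProd, Finset.prod_range_succ, shiftProd]
      push_cast
      congr 1
      · exact Finset.prod_congr rfl fun k _ => by ring
      · ring
    rw [h₂, forestPoly]
    simp
    ring

end Enumeration

/-! ### Weight vectors -/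

section Weights

variable {n : ℕ}

/-- The action of the torus element `diag(t, t⁻¹)`. -/
def scale (t : ℚˣ) : Alg n →ₐ[ℚ] Alg n :=
  lift (fun c i j => (if c then (t : ℚ) else ((t⁻¹ : ℚˣ) : ℚ)) • edge c i j)
    (fun c i j => by rw [edge_swap c i j, smul_neg])
    (fun c d i j => by rw [smul_mul_smul_comm, edge_mul_edge, smul_zero])
    (fun c d i j k => by
      simp only [smul_mul_smul_comm]
      rw [mul_comm (if d then (t : ℚ) else _)]
      simp only [← smul_add]
      rw [arnold, smul_zero])

theorem scale_edge (t : ℚˣ) (c : Bool) (i j : Fin n) :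
    scale t (edge c i j) = (if c then (t : ℚ) else ((t⁻¹ : ℚˣ) : ℚ)) • edge c i j := by
  by_cases h : i = j
  · subst h; simp [edge_self]
  · exact lift_edge _ _ _ _ h c

/-- The element `a` is a weight vector of weight `k`. -/
def HasWeight (k : ℤ) (a : Alg n) : Prop := ∀ t : ℚˣ, scale t a = ((t ^ k : ℚˣ) : ℚ) • a

theorem hasWeight_one : HasWeight 0 (1 : Alg n) := fun t => by simp

theorem HasWeight.mul {k l : ℤ} {a b : Alg n} (ha : HasWeight k a) (hb : HasWeight l b) :
    HasWeight (k + l) (a * b) := fun t => by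
  rw [map_mul, ha t, hb t, smul_mul_smul_comm, zpow_add, Units.val_mul]

theorem hasWeight_inEdge (m d : Fin n) : HasWeight 1 (inEdge m d) := fun t => by
  simp [inEdge, scale_edge]

theorem hasWeight_outEdge (m d : Fin n) : HasWeight (-1) (outEdge m d) := fun t => by
  simp [outEdge, scale_edge]

end Weights

/-! ### Bases of trees and forests -/

section Systems

open LaurentPolynomial (T)

variable {n : ℕ}

/-- The variable `q` of the character, which marks the edges of colour `x`. -/
abbrev qq : ℤ[T;T⁻¹] := T 1

/-- The inverse of the variable `q`, which marks the edges of colour `y`. -/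
abbrev qi : ℤ[T;T⁻¹] := T (-1)

instance : CharZero ℤ[T;T⁻¹] :=
  charZero_of_injective_ringHom (f := (LaurentPolynomial.C : ℤ →+* ℤ[T;T⁻¹]))
    ((injective_iff_map_eq_zero _).2 fun a ha => by
      by_contra h
      have := LaurentPolynomial.degree_C h
      rw [ha, LaurentPolynomial.degree_zero] at this
      exact WithBot.bot_ne_zero this)

theorem qq_ne_qi : qq ≠ qi := fun h => by
  have := congrArg LaurentPolynomial.degree h
  rw [LaurentPolynomial.degree_T, LaurentPolynomial.degree_T] at this
  exact absurd (WithBot.coe_injective this) (by decide)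

/-- A basis of the span of the tree monomials on `S`, consisting of tree monomials `elt t` that are
weight vectors, together with contractions `op t` from `S` to the vertices `rt t` whose scalar
values on the basis elements form a nondegenerate matrix. The field `count` evaluates the sum of
the powers of `q` given by the weights `wt t`. -/
structure TreeSystem (S : Finset (Fin n)) where
  ι : Type
  fin : Fintype ι
  elt : ι → Alg n
  op : ι → Alg n →ₗ[ℚ] Alg n
  rt : ι → Fin n
  wt : ι → ℤ
  rt_mem : ∀ t, rt t ∈ S
  isTree : ∀ t, IsTree S (elt t)
  contr : ∀ t, IsContr S (rt t) (op t)
  hasWeight : ∀ t, HasWeight (wt t) (elt t)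
  mem_span : ∀ a, IsTree S a → a ∈ Submodule.span ℚ (Set.range elt)
  nondeg : ∀ c : ι → ℚ, (∀ t, ∑ s, c s * aug n (op t (elt s)) = 0) → ∀ s, c s = 0
  count : ∑ t, (T (wt t) : ℤ[T;T⁻¹]) = shiftProd qq qi (S.card - 1) 0

attribute [instance] TreeSystem.fin

/-- The analogous data for the families of trees on the blocks of a partition of `D`, all joined
to `m` by edges of colour `y`. Here the elements span only up to lower-order terms, and the matrix
is nondegenerate for each number `nblk` of blocks separately. The contractions kill all multiples
of an edge of colour `x` between `D` and `m`, and `op f` removes at most `nblk f` edges at `m`. -/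
structure ForestSystem (m : Fin n) (D : Finset (Fin n)) where
  ι : Type
  fin : Fintype ι
  elt : ι → Alg n
  op : ι → Alg n →ₗ[ℚ] Alg n
  nblk : ι → ℕ
  wt : ι → ℤ
  part : ∀ f, Part (outEdge m) D (nblk f) (elt f)
  contr : ∀ f, IsContr (insert m D) m (op f)
  kill : ∀ f, ∀ d ∈ D, ∀ p, op f (inEdge m d * p) = 0
  filt : ∀ f k x, x ∈ edgeIdeal m ^ (k + nblk f) → op f x ∈ edgeIdeal m ^ k
  hasWeight : ∀ f, HasWeight (wt f) (elt f)
  mem_sup : ∀ r a, Part (outEdge m) D r a → a ∈ Submodule.span ℚ (Set.range elt) ⊔ lower m D r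
  nondeg : ∀ k, ∀ c : ι → ℚ, (∀ f, nblk f ≠ k → c f = 0) →
    (∀ f, nblk f = k → ∑ s, c s * aug n (op f (elt s)) = 0) → ∀ s, c s = 0
  count : ∑ f, (T (wt f) : ℤ[T;T⁻¹]) = forestPoly qq qi D.card qi

attribute [instance] ForestSystem.fin

/-- The analogous data for the forests on `D`, with linear forms `fn f` in place of the values of
the contractions. -/
structure PlainSystem (D : Finset (Fin n)) where
  ι : Type
  fin : Fintype ι
  elt : ι → Alg n
  fn : ι → Alg n →ₗ[ℚ] ℚ
  wt : ι → ℤ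
  inside : ∀ f, ∃ l, Inside D l ∧ mon l = elt f
  hasWeight : ∀ f, HasWeight (wt f) (elt f)
  mem_span : ∀ r a, Part 1 D r a → a ∈ Submodule.span ℚ (Set.range elt)
  nondeg : ∀ c : ι → ℚ, (∀ f, ∑ s, c s * fn f (elt s) = 0) → ∀ s, c s = 0
  count : ∑ f, (T (wt f) : ℤ[T;T⁻¹]) = forestPoly qq qi D.card 1

attribute [instance] PlainSystem.fin

theorem Part.mem_edgeIdeal_pow {m : Fin n} {Y : Finset (Fin n)} {r : ℕ} {a : Alg n}
    (h : Part (outEdge m) Y r a) : a ∈ edgeIdeal m ^ r := by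
  induction h with
  | nil => simp
  | @cons D Y r a b d hb hd hDY ha ih =>
    rw [pow_succ', mul_right_comm]
    exact Ideal.mul_mem_right _ _ (Ideal.mul_mem_mul (edge_mem_edgeIdeal _ _ _) ih)

theorem Part.isTree {m : Fin n} {Y : Finset (Fin n)} {r : ℕ} {a : Alg n}
    (h : Part (outEdge m) Y r a) (hm : m ∉ Y) : IsTree (insert m Y) a := by
  induction h with
  | nil => exact IsTree.single m
  | @cons D Y r a b d hb hd hDY ha ih =>
    rw [Finset.mem_union, not_or] at hm
    have := (ih hm.2).join false hb (Finset.disjoint_insert_left.2 ⟨hm.1, hDY.symm⟩)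
      (Finset.mem_insert_self _ _) hd
    rw [Finset.insert_union, Finset.union_comm Y D] at this
    convert this using 1
    rw [outEdge]
    ring

theorem ForestSystem.exists_mon {m : Fin n} {D : Finset (Fin n)} (F : ForestSystem m D)
    (hm : m ∉ D) (f : F.ι) : ∃ l, Inside (insert m D) l ∧ mon l = F.elt f := by
  obtain ⟨l, hl, -, h⟩ := ((F.part f).isTree hm).exists_mon
  exact ⟨l, hl, h⟩

theorem Part.eq_one_of_empty {w : Fin n → Alg n} {r : ℕ} {a : Alg n} (h : Part w ∅ r a) :
    a = 1 := by
  have hr : r = 0 := Nat.le_zero.1 (by simpa using h.card_le)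
  generalize (∅ : Finset (Fin n)) = Y at h
  subst hr
  cases h
  rfl

/-- The empty family of trees. -/
def ForestSystem.nil (m : Fin n) : ForestSystem m ∅ where
  ι := Unit
  fin := inferInstance
  elt _ := 1
  op _ := LinearMap.id
  nblk _ := 0
  wt _ := 0
  part _ := Part.nil
  contr _ := isContr_id m
  kill _ d hd := by simp at hd
  filt _ k x hx := hx
  hasWeight _ := hasWeight_one
  mem_sup r a h := by
    rw [h.eq_one_of_empty]
    exact Submodule.mem_sup_left (Submodule.subset_span ⟨(), rfl⟩)
  nondeg k c h₁ h₂ s := by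
    by_cases hk : k = 0
    · simpa using h₂ () hk.symm
    · exact h₁ () fun h => hk h.symm
  count := by simp [forestPoly]

/-- The empty forest. -/
def PlainSystem.nil : PlainSystem (n := n) ∅ where
  ι := Unit
  fin := inferInstance
  elt _ := 1
  fn _ := (aug n).toLinearMap
  wt _ := 0
  inside _ := ⟨[], by simp [Inside], rfl⟩
  hasWeight _ := hasWeight_one
  mem_span r a h := by
    rw [h.eq_one_of_empty]
    exact Submodule.subset_span ⟨(), rfl⟩
  nondeg c h s := by simpa using h ()
  count := by simp [forestPoly]

/-- The matrix of a forest system is triangular with respect to the number of blocks. -/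
theorem ForestSystem.nondeg_total {m : Fin n} {D : Finset (Fin n)} (F : ForestSystem m D)
    (c : F.ι → ℚ) (h : ∀ f, ∑ s, c s * aug n (F.op f (F.elt s)) = 0) : ∀ s, c s = 0 := by
  have key : ∀ k, ∀ s, F.nblk s = k → c s = 0 := by
    intro k
    induction k using Nat.strong_induction_on with
    | _ k ih =>
    have hc := F.nondeg k (fun s => if F.nblk s = k then c s else 0)
      (fun f hf => if_neg hf) fun f hf => by
        refine Eq.trans (Finset.sum_congr rfl fun s _ => ?_) (h f)
        rcases lt_trichotomy (F.nblk s) k with hs | hs | hs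
        · rw [if_neg hs.ne, ih _ hs s rfl]
        · rw [if_pos hs]
        · rw [if_neg hs.ne', zero_mul]
          have h1 := (F.part s).mem_edgeIdeal_pow
          rw [show F.nblk s = (F.nblk s - k - 1 + 1) + F.nblk f by omega] at h1
          have h2 := Ideal.pow_le_self (Nat.succ_ne_zero _) (F.filt f _ _ h1)
          rw [aug_eq_zero_of_mem h2, mul_zero]
    intro s hs
    simpa [hs] using hc s
  exact fun s => key _ s rfl

/-- One half of the nondegeneracy of a Kronecker product of matrices. -/
theorem TreeSystem.sum_eq_zero {S : Finset (Fin n)} (B : TreeSystem S) {κ : Type*} [Fintype κ]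
    (c : B.ι → κ → ℚ) (a : κ → ℚ)
    (h : ∀ t, ∑ t', ∑ f, c t' f * (aug n (B.op t (B.elt t')) * a f) = 0) (t' : B.ι) :
    ∑ f, c t' f * a f = 0 := by
  refine B.nondeg (fun t' => ∑ f, c t' f * a f) (fun t => ?_) t'
  rw [← h t]
  refine Finset.sum_congr rfl fun s _ => ?_
  rw [Finset.sum_mul]
  exact Finset.sum_congr rfl fun f _ => by ring

/-- If the first block differs from that of the row, then a matrix entry vanishes: either the block
is not contained in the one of the column, and its contraction vanishes; or it is a proper subset,
and then so many edges at `m` remain that they cannot all be removed. -/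
theorem aug_residue_eq_zero {m r z : Fin n} {D B B' E' : Finset (Fin n)} {s : ℕ}
    {G H : Alg n →ₗ[ℚ] Alg n} (hm : m ∉ D) (hB : B ⊆ D) (hu : B' ∪ E' = D)
    (hd : Disjoint B' E') (hz : z ∈ B) (hz' : z ∈ B') (hne : B ≠ B') (hG : IsContr B r G)
    (hr : r ∈ B) (hH : ∀ k x, x ∈ edgeIdeal m ^ (k + s) → H x ∈ edgeIdeal m ^ k) {a b : Alg n}
    (ha : IsTree B' a) (hb : Part (outEdge m) E' s b) :
    aug n (H (residue false m r (G (outEdge m z * a * b)))) = 0 := by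
  have hmB : m ∉ B := fun h => hm (hB h)
  have hmB' : m ∉ B' := fun h => hm (hu ▸ Finset.mem_union_left _ h)
  have hmE' : m ∉ E' := fun h => hm (hu ▸ Finset.mem_union_right _ h)
  obtain ⟨l, hl, hlen, rfl⟩ := ha.exists_mon
  obtain ⟨l', hl', -, hbl⟩ := (hb.isTree hmE').exists_mon
  rw [mul_assoc, outEdge, hG.out _ _ _ _ fun h => hmB h.1]
  by_cases hsub : B ⊆ B'
  · obtain ⟨c, y, hy, p, hp⟩ := hG.exists_edge ⟨z, hz⟩ (hsub.ssubset_of_ne hne) hl hlen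
    rw [Finset.mem_sdiff] at hy
    rw [mul_comm (mon l), ← hbl, hG.pull hl' (fun v hv hvB => by
      rcases Finset.mem_insert.1 hv with rfl | hv
      · exact absurd hvB hmB
      · exact absurd hv (Finset.disjoint_left.1 hd (hsub hvB))), hp, hbl,
      collapse, if_neg hmB, collapse, if_pos hz]
    have hre : edge false m r * (b * (edge c r y * p)) = edge c r y * (edge false m r * b * p) := by
      ring
    have hmr : m ≠ r := fun h => hmB (h ▸ hr)
    have hyS : y ∉ ({m, r} : Finset (Fin n)) := fun h => by
      rcases Finset.mem_insert.1 h with rfl | h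
      · exact hmB' hy.1
      · exact hy.2 (Finset.mem_singleton.1 h ▸ hr)
    rw [hre, (isContr_residue false hmr).out _ _ _ _ fun h => hyS h.2, collapse,
      if_pos (by simp), collapse, if_neg hyS]
    have h1 : edge false m r * b * p ∈ edgeIdeal m ^ (s + 1) := by
      rw [pow_succ']
      exact Ideal.mul_mem_right _ _
        (Ideal.mul_mem_mul (edge_mem_edgeIdeal _ _ _) hb.mem_edgeIdeal_pow)
    have h2 : edge c m y * residue false m r (edge false m r * b * p) ∈ edgeIdeal m ^ (1 + s) := by
      rw [pow_add, pow_one]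
      exact Ideal.mul_mem_mul (edge_mem_edgeIdeal _ _ _) (residue_mem_pow _ _ _ h1)
    exact aug_eq_zero_of_mem (by simpa using hH 1 _ h2)
  · obtain ⟨v, hv, hv'⟩ := Finset.not_subset.1 hsub
    have hvE : v ∈ E' := (Finset.mem_union.1 (hu.symm ▸ hB hv)).resolve_left hv'
    rw [← hbl, hG.mon_mul_mon_eq_zero (P := B') (P' := insert m E')
      (Finset.disjoint_insert_right.2 ⟨hmB', hd⟩)
      (hB.trans (hu ▸ Finset.union_subset_union_right (Finset.subset_insert _ _)))
      ⟨z, Finset.mem_inter.2 ⟨hz, hz'⟩⟩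
      ⟨v, Finset.mem_inter.2 ⟨hv, Finset.mem_insert_of_mem hvE⟩⟩ hl hl']
    simp

/-- The matrix entry for equal first blocks is the product of those for the tree on this block and
for the remaining blocks. -/
theorem residue_contr {m r z : Fin n} {B E : Finset (Fin n)} {G : Alg n →ₗ[ℚ] Alg n} (hm : m ∉ B)
    (hd : Disjoint B E) (hz : z ∈ B) (hG : IsContr B r G) (hr : r ∈ B) {a b : Alg n}
    (ha : IsTree B a) (hb : ∃ l, Inside (insert m E) l ∧ mon l = b) :
    residue false m r (G (outEdge m z * a * b)) = aug n (G a) • b := by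
  obtain ⟨l, hl, -, rfl⟩ := ha.exists_mon
  obtain ⟨l', hl', rfl⟩ := hb
  have hmr : m ≠ r := fun h => hm (h ▸ hr)
  rw [mul_assoc, outEdge, hG.out _ _ _ _ fun h => hm h.1, mul_comm (mon l),
    hG.pull hl' (fun v hv hvB => by
      rcases Finset.mem_insert.1 hv with rfl | hv
      · exact absurd hvB hm
      · exact absurd hv (Finset.disjoint_left.1 hd hvB)), hG.scalar hl, collapse, if_neg hm,
    collapse, if_pos hz, mul_left_comm, mul_comm (edge false m r), ← Algebra.smul_def,
    mul_smul_comm, map_smul]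
  rw [(isContr_residue false hmr).pull hl' (fun v hv hvS => by
    rcases Finset.mem_insert.1 hvS with rfl | h
    · rfl
    · rcases Finset.mem_insert.1 hv with rfl | hv
      · rfl
      · exact absurd hv (Finset.disjoint_left.1 hd (Finset.mem_singleton.1 h ▸ hr))),
    residue_edge, coeffEdge]
  simp [hmr]

theorem mul_mul_mem_of_mem_span {s t : Set (Alg n)} {Z : Submodule ℚ (Alg n)} (w : Alg n)
    {a b : Alg n} (ha : a ∈ Submodule.span ℚ s) (hb : b ∈ Submodule.span ℚ t)
    (h : ∀ x ∈ s, ∀ y ∈ t, w * x * y ∈ Z) : w * a * b ∈ Z := by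
  induction ha, hb using Submodule.span_induction₂ with
  | mem_mem x y hx hy => exact h x hx y hy
  | zero_left y hy => simp
  | zero_right x hx => simp
  | add_left x y z _ _ _ hx hy => rw [mul_add, add_mul]; exact add_mem hx hy
  | add_right x y z _ _ _ hx hy => rw [mul_add]; exact add_mem hx hy
  | smul_left r x y _ _ hx => rw [mul_smul_comm, smul_mul_assoc]; exact Submodule.smul_mem _ _ hx
  | smul_right r x y _ _ hx => rw [mul_smul_comm]; exact Submodule.smul_mem _ _ hx

theorem union_pair_union {B E D : Finset (Fin n)} (hu : B ∪ E = D) {r : Fin n} (hr : r ∈ B)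
    (m : Fin n) : B ∪ {m, r} ∪ insert m E = insert m D := by
  subst hu
  ext v
  simp only [Finset.mem_union, Finset.mem_insert, Finset.mem_singleton]
  constructor
  · rintro ((h | h | h) | h | h)
    · exact Or.inr (Or.inl h)
    · exact Or.inl h
    · exact Or.inr (Or.inl (h ▸ hr))
    · exact Or.inl h
    · exact Or.inr (Or.inr h)
  · rintro (h | h | h)
    · exact Or.inr (Or.inl h)
    · exact Or.inl (Or.inl h)
    · exact Or.inr (Or.inr h)

/-- Forest systems are built by choosing the vertex set of the tree that contains a given
vertex. -/
theorem ForestSystem.nonempty_cons {m z : Fin n} {D : Finset (Fin n)} (hm : m ∉ D) (hz : z ∈ D)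
    (B : ∀ p : {p // p ∈ (D.erase z).powerset}, TreeSystem (insert z p.1))
    (F : ∀ p : {p // p ∈ (D.erase z).powerset}, ForestSystem m (D.erase z \ p.1)) :
    Nonempty (ForestSystem m D) := by
  have hsub : ∀ p : {p // p ∈ (D.erase z).powerset}, insert z p.1 ⊆ D := fun p =>
    Finset.insert_subset hz ((Finset.mem_powerset.1 p.2).trans (Finset.erase_subset _ _))
  have hmB : ∀ p : {p // p ∈ (D.erase z).powerset}, m ∉ insert z p.1 := fun p h => hm (hsub p h)
  have hmE : ∀ p : {p // p ∈ (D.erase z).powerset}, m ∉ D.erase z \ p.1 := fun p h =>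
    hm (Finset.mem_of_mem_erase (Finset.mem_sdiff.1 h).1)
  have hd : ∀ p : {p // p ∈ (D.erase z).powerset}, Disjoint (insert z p.1) (D.erase z \ p.1) :=
    fun p => Finset.disjoint_insert_left.2 ⟨fun h => by simp at h, Finset.disjoint_sdiff⟩
  have hu : ∀ p : {p // p ∈ (D.erase z).powerset},
      insert z p.1 ∪ (D.erase z \ p.1) = D := fun p => by
    rw [Finset.insert_union, Finset.union_sdiff_of_subset (Finset.mem_powerset.1 p.2),
      Finset.insert_erase hz]
  have hmr : ∀ p t, m ≠ (B p).rt t := fun p t h => hmB p (h ▸ (B p).rt_mem t)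
  have hrE : ∀ p t, (B p).rt t ∉ D.erase z \ p.1 := fun p t h =>
    Finset.disjoint_left.1 (hd p) ((B p).rt_mem t) h
  refine ⟨{
    ι := Σ p, (B p).ι × (F p).ι
    fin := inferInstance
    elt := fun f => outEdge m z * (B f.1).elt f.2.1 * (F f.1).elt f.2.2
    op := fun f => (F f.1).op f.2.2 ∘ₗ residue false m ((B f.1).rt f.2.1) ∘ₗ (B f.1).op f.2.1
    nblk := fun f => (F f.1).nblk f.2.2 + 1
    wt := fun f => -1 + (B f.1).wt f.2.1 + (F f.1).wt f.2.2
    part := ?_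
    contr := ?_
    kill := ?_
    filt := ?_
    hasWeight := fun f =>
      ((hasWeight_outEdge m z).mul ((B f.1).hasWeight f.2.1)).mul ((F f.1).hasWeight f.2.2)
    mem_sup := ?_
    nondeg := ?_
    count := ?_ }⟩
  · rintro ⟨p, t, f⟩
    have := ((F p).part f).cons ((B p).isTree t) (Finset.mem_insert_self _ _) (hd p)
    rwa [hu] at this
  · rintro ⟨p, t, f⟩
    have h1 := ((B p).contr t).comp (isContr_residue false (hmr p t)) (by
      rw [Finset.inter_insert_of_notMem (hmB p), Finset.inter_singleton_of_mem ((B p).rt_mem t)])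
    have h2 := h1.comp ((F p).contr f) (by
      have h3 : m ∈ insert z p.1 ∪ {m, (B p).rt t} := by simp
      rw [Finset.inter_insert_of_mem h3, Finset.disjoint_iff_inter_eq_empty.1]
      · rfl
      · rw [Finset.disjoint_union_left]
        refine ⟨hd p, ?_⟩
        rw [Finset.disjoint_insert_left, Finset.disjoint_singleton_left]
        exact ⟨hmE p, hrE p t⟩)
    have h4 : insert z p.1 ∪ {m, (B p).rt t} ∪ insert m (D.erase z \ p.1) = insert m D  :=
      union_pair_union (hu p) ((B p).rt_mem t) m
    rwa [h4] at h2
  · rintro ⟨p, t, f⟩ d hdD x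
    simp only [LinearMap.comp_apply]
    rw [inEdge, ((B p).contr t).out _ _ _ _ fun h => hmB p h.2]
    have hcm : collapse (insert z p.1) ((B p).rt t) m = m := by rw [collapse, if_neg (hmB p)]
    rw [hcm]
    rcases Finset.mem_union.1 ((hu p).symm ▸ hdD) with h | h
    · rw [collapse, if_pos h, residue_mul, residue_edge, mapHom_edge, collapse, if_pos (by simp),
        collapse, if_pos (by simp), edge_self, coeffEdge]
      simp
    · have hdB : d ∉ insert z p.1 := Finset.disjoint_right.1 (hd p) h
      have hdS : d ∉ ({m, (B p).rt t} : Finset (Fin n)) := by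
        rw [Finset.mem_insert, Finset.mem_singleton, not_or]
        exact ⟨fun h' => hmE p (h' ▸ h), fun h' => hrE p t (h' ▸ h)⟩
      rw [collapse, if_neg hdB, (isContr_residue false (hmr p t)).out _ _ _ _ fun h => hdS h.1,
        collapse, if_neg hdS, collapse, if_pos (by simp)]
      exact (F p).kill f d h _
  · rintro ⟨p, t, f⟩ k x hx
    refine (F p).filt f k _ (residue_mem_pow _ _ _ ?_)
    exact ((B p).contr t).map_mem_pow (hmB p) hx
  · intro r a ha
    obtain ⟨X, b, d, Y, r', a', hb, hdX, hXY, ha', hzX, rfl, rfl, rfl⟩ := ha.exists_block hz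
    have hzY : z ∉ Y := Finset.disjoint_left.1 hXY hzX
    obtain ⟨p, hp⟩ : ∃ p : {p // p ∈ ((X ∪ Y).erase z).powerset}, p.1 = X.erase z :=
      ⟨⟨X.erase z, Finset.mem_powerset.2 (Finset.erase_subset_erase _ Finset.subset_union_left)⟩,
        rfl⟩
    have hpX : insert z p.1 = X := by rw [hp, Finset.insert_erase hzX]
    have hpY : (X ∪ Y).erase z \ p.1 = Y := by
      have h1 := hd p
      have h2 := hu p
      rw [hpX] at h1 h2
      rw [← Finset.union_sdiff_cancel_left h1, h2, Finset.union_sdiff_cancel_left hXY]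
    have hsplit : outEdge m d * b * a' =
        (outEdge m d - outEdge m z) * b * a' + outEdge m z * b * a' := by ring
    rw [hsplit]
    refine add_mem (Submodule.mem_sup_right ?_) ?_
    · have := ha'.mul_mem_lower (hb.sub_mul_mem_lower (m := m) hdX hzX) hXY.symm
      rwa [mul_comm, Finset.union_comm] at this
    have hbspan := (B p).mem_span b (by rwa [hpX])
    have haspan := (F p).mem_sup r' a' (by rwa [hpY])
    obtain ⟨x, hx, y, hy, rfl⟩ := Submodule.mem_sup.1 haspan
    rw [hpY] at hy
    rw [mul_add]
    refine add_mem (Submodule.mem_sup_left ?_) (Submodule.mem_sup_right ?_)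
    · refine mul_mul_mem_of_mem_span (outEdge m z) hbspan hx ?_
      rintro - ⟨t, rfl⟩ - ⟨f, rfl⟩
      exact Submodule.subset_span ⟨⟨p, t, f⟩, rfl⟩
    · have := (hb.part (w := outEdge m) hzX).mul_mem_lower hy hXY
      rwa [add_comm] at this
  · intro k c hck hc
    have hrow : ∀ p t f, (F p).nblk f + 1 = k → ∑ t', ∑ f', c ⟨p, t', f'⟩ *
        (aug n ((B p).op t ((B p).elt t')) * aug n ((F p).op f ((F p).elt f'))) = 0 := by
      intro p t f hf
      rw [← hc ⟨p, t, f⟩ hf, Fintype.sum_sigma, Finset.sum_eq_single p]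
      · rw [Fintype.sum_prod_type]
        refine Finset.sum_congr rfl fun t' _ => Finset.sum_congr rfl fun f' _ => ?_
        simp only [LinearMap.comp_apply]
        rw [residue_contr (hmB p) (hd p) (Finset.mem_insert_self _ _) ((B p).contr t)
          ((B p).rt_mem t) ((B p).isTree t') ((F p).exists_mon (hmE p) f'), map_smul, map_smul,
          smul_eq_mul]
      · intro p' _ hp'
        refine Finset.sum_eq_zero fun ⟨t', f'⟩ _ => ?_
        by_cases hk : (F p').nblk f' + 1 = k
        · have hnb : (F p').nblk f' = (F p).nblk f := by omega
          simp only [LinearMap.comp_apply]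
          rw [aug_residue_eq_zero hm (hsub p) (hu p') (hd p') (Finset.mem_insert_self _ _)
            (Finset.mem_insert_self _ _) (fun h => hp' ?_) ((B p).contr t) ((B p).rt_mem t)
            ((F p).filt f) ((B p').isTree t') (hnb ▸ (F p').part f'), mul_zero]
          have hz1 : ∀ p : {p // p ∈ (D.erase z).powerset}, z ∉ p.1 := fun p h =>
            Finset.notMem_erase z D (Finset.mem_powerset.1 p.2 h)
          exact Subtype.ext (by
            rw [← Finset.erase_insert (hz1 p), h, Finset.erase_insert (hz1 p')])
        · rw [hck _ hk, zero_mul]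
      · intro h
        exact absurd (Finset.mem_univ p) h
    rintro ⟨p, t', f'⟩
    cases k with
    | zero => exact hck _ (Nat.succ_ne_zero _)
    | succ k =>
      refine (F p).nondeg k (fun f' => c ⟨p, t', f'⟩)
        (fun f hf => hck _ fun h => hf (by simpa using h))
        (fun f hf => ?_) f'
      exact (B p).sum_eq_zero (fun t' f' => c ⟨p, t', f'⟩) _ (fun t => hrow p t f (by omega)) t'
  · have hcard : ∀ p : {p // p ∈ (D.erase z).powerset}, (insert z p.1).card - 1 = p.1.card :=
      fun p => by
        rw [Finset.card_insert_of_notMem fun h =>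
          Finset.notMem_erase z D (Finset.mem_powerset.1 p.2 h), Nat.add_sub_cancel]
    have h1 : ∀ p, ∑ x : (B p).ι × (F p).ι, (T (-1 + (B p).wt x.1 + (F p).wt x.2) : ℤ[T;T⁻¹]) =
        qi * (shiftProd qq qi p.1.card 0 * forestPoly qq qi (D.erase z \ p.1).card qi) := by
      intro p
      rw [← (F p).count, ← hcard p, ← (B p).count, Fintype.sum_prod_type, Finset.sum_mul_sum,
        Finset.mul_sum]
      refine Finset.sum_congr rfl fun t _ => ?_
      rw [Finset.mul_sum]
      exact Finset.sum_congr rfl fun f _ => by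
        rw [LaurentPolynomial.T_add, LaurentPolynomial.T_add, mul_assoc]
    rw [Fintype.sum_sigma]
    simp only [h1]
    rw [Finset.sum_coe_sort (D.erase z).powerset fun p => qi * (shiftProd qq qi p.card 0 *
      forestPoly qq qi (D.erase z \ p).card qi), sum_powerset_forestPoly qq_ne_qi,
      Finset.card_erase_add_one hz]

end Systems

/-! ### Construction of the bases -/

section Existence

open LaurentPolynomial (T)

variable {n : ℕ}

theorem ForestSystem.exists_of_trees {m : Fin n} (D : Finset (Fin n)) (hm : m ∉ D)
    (B : ∀ C ⊆ D, C.Nonempty → Nonempty (TreeSystem C)) : Nonempty (ForestSystem m D) := by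
  induction D using Finset.strongInduction with
  | H D ih =>
  rcases D.eq_empty_or_nonempty with rfl | ⟨z, hz⟩
  · exact ⟨ForestSystem.nil m⟩
  have hsub : ∀ p ∈ (D.erase z).powerset, insert z p ⊆ D := fun p hp =>
    Finset.insert_subset hz ((Finset.mem_powerset.1 hp).trans (Finset.erase_subset _ _))
  have hlt : ∀ p : Finset (Fin n), D.erase z \ p ⊂ D := fun p =>
    lt_of_le_of_lt Finset.sdiff_subset (Finset.erase_ssubset hz)
  exact ForestSystem.nonempty_cons hm hz
    (fun p => (B _ (hsub p.1 p.2) (Finset.insert_nonempty _ _)).some)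
    (fun p => (ih _ (hlt p.1) (fun h => hm ((hlt p.1).1 h))
      fun C hC => B C (hC.trans (hlt p.1).1)).some)

/-- If the block that is joined to `m` by an edge of colour `x` meets the vertex set of a row, then
the matrix entry vanishes. -/
theorem ForestSystem.op_inEdge_eq_zero {m i : Fin n} {D E C' E' : Finset (Fin n)}
    (F : ForestSystem m E) (f : F.ι) (hm : m ∉ D) (hE : E ⊆ D) (hu : C' ∪ E' = D)
    (hd : Disjoint C' E') (h : (C' ∩ E).Nonempty) (hi : i ∈ C') {a b : Alg n} (ha : IsTree C' a)
    (hb : ∃ l, Inside (insert m E') l ∧ mon l = b) : F.op f (inEdge m i * a * b) = 0 := by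
  have hmC : m ∉ C' := fun h => hm (hu ▸ Finset.mem_union_left _ h)
  have him : i ≠ m := fun h => hmC (h ▸ hi)
  rw [mul_assoc]
  by_cases hiE : i ∈ E
  · exact F.kill f i hiE _
  obtain ⟨l, hl, -, rfl⟩ := ha.exists_mon
  obtain ⟨l', hl', rfl⟩ := hb
  rw [inEdge, (F.contr f).out _ _ _ _ fun h => (Finset.mem_insert.1 h.1).elim him hiE,
    (F.contr f).mon_mul_mon_eq_zero (P := C') (P' := insert m E')
      (Finset.disjoint_insert_right.2 ⟨hmC, hd⟩) ?_ ?_ ?_ hl hl', mul_zero]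
  · rw [Finset.union_insert, hu]
    exact Finset.insert_subset_insert _ hE
  · rw [Finset.inter_comm] at h
    exact h.mono (Finset.inter_subset_inter_right (Finset.subset_insert _ _))
  · exact ⟨m, by simp⟩

/-- The matrix entry for equal blocks with an `x`-edge at `m`: it vanishes unless the ends `i`, `i'`
of the edges agree, and then it is the product of the entries for the tree on the block and for the
`y`-part. -/
theorem residue_inEdge {m i i' : Fin n} {C E : Finset (Fin n)} {G : Alg n →ₗ[ℚ] Alg n}
    (hG : IsContr (insert m E) m G) (hm : m ∉ C) (hd : Disjoint C E) (hi : i ∈ C) (hi' : i' ∈ C)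
    {a b : Alg n} (ha : IsTree C a) (hb : ∃ l, Inside (insert m E) l ∧ mon l = b) :
    residue true i m (G (inEdge m i' * a * b)) = (if i' = i then aug n (G b) else 0) • a := by
  obtain ⟨l, hl, -, rfl⟩ := ha.exists_mon
  obtain ⟨l', hl', rfl⟩ := hb
  have him : i ≠ m := fun h => hm (h ▸ hi)
  have him' : i' ≠ m := fun h => hm (h ▸ hi')
  have hiE : i' ∉ insert m E := fun h =>
    (Finset.mem_insert.1 h).elim him' (Finset.disjoint_left.1 hd hi')
  rw [mul_assoc, inEdge, hG.out _ _ _ _ fun h => hiE h.1, hG.pull hl (fun v hv hvE =>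
    (Finset.mem_insert.1 hvE).resolve_right (Finset.disjoint_left.1 hd hv)), hG.scalar hl',
    collapse, if_neg hiE, collapse, if_pos (Finset.mem_insert_self _ _), mul_left_comm, mul_comm,
    mul_right_comm, mul_comm (edge true i' m * _), ← Algebra.smul_def, mul_comm (edge true i' m),
    map_smul,
    (isContr_residue true him).pull hl (fun v hv hvS => by
      rcases Finset.mem_insert.1 hvS with h | h
      · exact h
      · exact absurd (Finset.mem_singleton.1 h ▸ hv) hm), residue_edge, coeffEdge]
  by_cases h : i' = i
  · simp [h, him]
  · simp [h, him']

/-- Tree systems are built by choosing the set of the vertices that are joined to a given vertex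
`m` by a block with an edge of colour `x`. -/
theorem TreeSystem.nonempty_insert {m : Fin n} {D : Finset (Fin n)} (hm : m ∉ D)
    (B : ∀ C : {C // C ∈ D.powerset.erase ∅}, TreeSystem C.1)
    (F : ∀ Y, Y ⊆ D → ForestSystem m Y) : Nonempty (TreeSystem (insert m D)) := by
  let E : ∀ C : {C // C ∈ D.powerset.erase ∅}, ForestSystem m (D \ C.1) := fun C =>
    F (D \ C.1) Finset.sdiff_subset
  have hsub : ∀ C : {C // C ∈ D.powerset.erase ∅}, C.1 ⊆ D := fun C =>
    Finset.mem_powerset.1 (Finset.mem_of_mem_erase C.2)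
  have hmC : ∀ C : {C // C ∈ D.powerset.erase ∅}, m ∉ C.1 := fun C h => hm (hsub C h)
  have hmE : ∀ C : Finset (Fin n), m ∉ D \ C := fun C h => hm (Finset.mem_sdiff.1 h).1
  have hd : ∀ C : Finset (Fin n), Disjoint C (D \ C) := fun C => Finset.disjoint_sdiff
  have hu : ∀ C : {C // C ∈ D.powerset.erase ∅}, C.1 ∪ (D \ C.1) = D := fun C =>
    Finset.union_sdiff_of_subset (hsub C)
  have him : ∀ (C : {C // C ∈ D.powerset.erase ∅}), ∀ i ∈ C.1, i ≠ m := fun C i hi h =>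
    hmC C (h ▸ hi)
  refine ⟨{
    ι := (F D subset_rfl).ι ⊕ Σ C : {C // C ∈ D.powerset.erase ∅},
      {i // i ∈ C.1} × (B C).ι × (E C).ι
    fin := inferInstance
    elt := Sum.elim (F D subset_rfl).elt fun x =>
      inEdge m x.2.1 * (B x.1).elt x.2.2.1 * (E x.1).elt x.2.2.2
    op := Sum.elim (F D subset_rfl).op fun x =>
      (B x.1).op x.2.2.1 ∘ₗ residue true x.2.1 m ∘ₗ (E x.1).op x.2.2.2
    rt := Sum.elim (fun _ => m) fun x => (B x.1).rt x.2.2.1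
    wt := Sum.elim (F D subset_rfl).wt fun x =>
      1 + (B x.1).wt x.2.2.1 + (E x.1).wt x.2.2.2
    rt_mem := ?_
    isTree := ?_
    contr := ?_
    hasWeight := ?_
    mem_span := ?_
    nondeg := ?_
    count := ?_ }⟩
  · rintro (f | ⟨C, i, t, f⟩)
    · exact Finset.mem_insert_self _ _
    · exact Finset.mem_insert_of_mem (hsub C ((B C).rt_mem t))
  · rintro (f | ⟨C, ⟨i, hi⟩, t, f⟩)
    · exact ((F D subset_rfl).part f).isTree hm
    · have := ((B C).isTree t).join true (((E C).part f).isTree (hmE C))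
        (Finset.disjoint_insert_right.2 ⟨hmC C, hd C⟩) hi (Finset.mem_insert_self _ _)
      rw [Finset.union_insert, hu] at this
      convert this using 1
      simp only [Sum.elim_inr, inEdge]
      ring
  · rintro (f | ⟨C, ⟨i, hi⟩, t, f⟩)
    · exact (F D subset_rfl).contr f
    · have h1 := ((E C).contr f).comp (isContr_residue true (him C i hi)) (by
        have : i ∉ insert m (D \ C.1) := by simp [him C i hi, hi]
        rw [Finset.inter_insert_of_notMem this, Finset.inter_singleton_of_mem
          (Finset.mem_insert_self _ _)])
      have h2 := h1.comp ((B C).contr t) (by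
        ext v
        have : v = m → v ∉ C.1 := fun h => h ▸ hmC C
        have : v = i → v ∈ C.1 := fun h => h ▸ hi
        simp only [Finset.mem_inter, Finset.mem_union, Finset.mem_insert, Finset.mem_sdiff,
          Finset.mem_singleton]
        tauto)
      have h3 : insert m (D \ C.1) ∪ {i, m} ∪ C.1 = insert m D := by
        rw [← union_pair_union (hu C) hi m, Finset.pair_comm, Finset.union_comm _ C.1,
          Finset.union_comm (insert m _), Finset.union_assoc]
      rwa [h3] at h2
  · rintro (f | ⟨C, ⟨i, hi⟩, t, f⟩)
    · exact (F D subset_rfl).hasWeight f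
    · exact ((hasWeight_inEdge m i).mul ((B C).hasWeight t)).mul ((E C).hasWeight f)
  · intro a ha
    have h1 := ha.mem_stars (Finset.mem_insert_self m D)
    rw [Finset.erase_insert hm] at h1
    refine stars_le (fun Y => if h : Y ⊆ D then Submodule.span ℚ (Set.range (F Y h).elt) else ⊥)
      (fun Y hY r b hb => ?_) _ ?_ ?_ h1
    · simp only [dif_pos hY]
      exact (F Y hY).mem_sup r b hb
    · simp only [subset_rfl, dif_pos]
      refine Submodule.span_le.2 ?_
      rintro - ⟨f, rfl⟩
      exact Submodule.subset_span ⟨Sum.inl f, rfl⟩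
    · intro X hX a i hi ha b hb
      simp only [Finset.sdiff_subset, dif_pos] at hb
      obtain ⟨C, rfl⟩ : ∃ C : {C // C ∈ D.powerset.erase ∅}, C.1 = X :=
        ⟨⟨X, Finset.mem_erase.2 ⟨Finset.ne_empty_of_mem hi, Finset.mem_powerset.2 hX⟩⟩, rfl⟩
      refine mul_mul_mem_of_mem_span _ ((B C).mem_span a ha) hb ?_
      rintro - ⟨t, rfl⟩ - ⟨f, rfl⟩
      exact Submodule.subset_span ⟨Sum.inr ⟨C, ⟨i, hi⟩, t, f⟩, rfl⟩
  · intro c hc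
    -- The contractions of the rows without an `x`-edge at `m` kill the columns with one.
    have hinl : ∀ f, c (Sum.inl f) = 0 := by
      refine (F D subset_rfl).nondeg_total _ fun f => ?_
      have h1 := hc (Sum.inl f)
      rw [Fintype.sum_sum_type, Finset.sum_eq_zero (s := Finset.univ (α := Σ C, _)), add_zero] at h1
      · exact h1
      · rintro ⟨C, ⟨i, hi⟩, t, f'⟩ -
        simp only [Sum.elim_inl, Sum.elim_inr]
        rw [(F D subset_rfl).op_inEdge_eq_zero f hm subset_rfl (hu C) (hd C)
          ⟨i, Finset.mem_inter.2 ⟨hi, hsub C hi⟩⟩ hi ((B C).isTree t)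
          ((E C).exists_mon (hmE C) f'), map_zero, mul_zero]
    -- The entries with row block `C` and column block `C'` vanish unless `C' ⊆ C`.
    have hinr : ∀ C x, c (Sum.inr ⟨C, x⟩) = 0 := by
      rintro ⟨C, hC⟩
      induction C using Finset.strongInduction with
      | H C ih =>
      set C₀ : {C // C ∈ D.powerset.erase ∅} := ⟨C, hC⟩
      rintro ⟨⟨i, hi⟩, t', f'⟩
      refine (E C₀).nondeg_total (fun f => c (Sum.inr ⟨C₀, ⟨i, hi⟩, t', f⟩)) (fun f => ?_) f'
      refine (B C₀).sum_eq_zero (fun t f => c (Sum.inr ⟨C₀, ⟨i, hi⟩, t, f⟩)) _ (fun t => ?_) t'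
      refine Eq.trans ?_ (hc (Sum.inr ⟨C₀, ⟨i, hi⟩, t, f⟩))
      rw [Fintype.sum_sum_type]
      simp only [hinl, zero_mul, Finset.sum_const_zero, zero_add]
      rw [Fintype.sum_sigma, Finset.sum_eq_single C₀, Fintype.sum_prod_type,
        Finset.sum_eq_single (⟨i, hi⟩ : {i // i ∈ C₀.1}), Fintype.sum_prod_type]
      · refine Finset.sum_congr rfl fun t' _ => Finset.sum_congr rfl fun f' _ => ?_
        simp only [Sum.elim_inr, LinearMap.comp_apply]
        rw [residue_inEdge ((E C₀).contr f) (hmC C₀) (hd C) hi hi ((B C₀).isTree t')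
          ((E C₀).exists_mon (hmE C) f'), if_pos rfl, map_smul, map_smul, smul_eq_mul, mul_comm
          (aug n _)]
      · rintro ⟨i', hi'⟩ _ hne
        refine Finset.sum_eq_zero fun ⟨t', f'⟩ _ => ?_
        simp only [Sum.elim_inr, LinearMap.comp_apply]
        rw [residue_inEdge ((E C₀).contr f) (hmC C₀) (hd C) hi hi' ((B C₀).isTree t')
          ((E C₀).exists_mon (hmE C) f'), if_neg fun h => hne (Subtype.ext h), zero_smul, map_zero,
          map_zero, mul_zero]
      · exact fun h => absurd (Finset.mem_univ _) h
      · rintro ⟨C', hC'⟩ _ hne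
        set C₁ : {C // C ∈ D.powerset.erase ∅} := ⟨C', hC'⟩
        refine Finset.sum_eq_zero ?_
        rintro ⟨⟨i', hi'⟩, t', f'⟩ -
        by_cases hCC : C' ⊆ C
        · rw [ih C' (hCC.ssubset_of_ne fun h => hne (Subtype.ext h)) hC', zero_mul]
        · obtain ⟨v, hv, hv'⟩ := Finset.not_subset.1 hCC
          simp only [Sum.elim_inr, LinearMap.comp_apply]
          rw [(E C₀).op_inEdge_eq_zero f hm Finset.sdiff_subset (hu C₁) (hd C')
            ⟨v, Finset.mem_inter.2 ⟨hv, Finset.mem_sdiff.2 ⟨hsub C₁ hv, hv'⟩⟩⟩ hi'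
            ((B C₁).isTree t') ((E C₁).exists_mon (hmE C') f')]
          simp
      · exact fun h => absurd (Finset.mem_univ _) h
    rintro (f | ⟨C, x⟩)
    · exact hinl f
    · exact hinr C x
  · have h1 : ∀ C : {C // C ∈ D.powerset.erase ∅},
        ∑ x : {i // i ∈ C.1} × (B C).ι × (E C).ι,
          (T (1 + (B C).wt x.2.1 + (E C).wt x.2.2) : ℤ[T;T⁻¹]) =
        (C.1.card : ℤ[T;T⁻¹]) * qq * (shiftProd qq qi (C.1.card - 1) 0 *
          forestPoly qq qi (D \ C.1).card qi) := by
      intro C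
      have h2 : ∀ i : {i // i ∈ C.1}, ∑ x : (B C).ι × (E C).ι,
          (T (1 + (B C).wt x.1 + (E C).wt x.2) : ℤ[T;T⁻¹]) =
          qq * (shiftProd qq qi (C.1.card - 1) 0 * forestPoly qq qi (D \ C.1).card qi) := by
        intro i
        rw [← (E C).count, ← (B C).count, Fintype.sum_prod_type, Finset.sum_mul_sum,
          Finset.mul_sum]
        refine Finset.sum_congr rfl fun t _ => ?_
        rw [Finset.mul_sum]
        exact Finset.sum_congr rfl fun f _ => by
          rw [LaurentPolynomial.T_add, LaurentPolynomial.T_add, mul_assoc]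
      rw [Fintype.sum_prod_type, Finset.sum_congr rfl fun i _ => h2 i, Finset.sum_const,
        Finset.card_univ, Fintype.card_coe,
        nsmul_eq_mul, mul_assoc]
    rw [Fintype.sum_sum_type, Fintype.sum_sigma]
    simp only [Sum.elim_inl, Sum.elim_inr, h1]
    rw [(F D subset_rfl).count, Finset.sum_coe_sort (D.powerset.erase ∅) fun C =>
      (C.card : ℤ[T;T⁻¹]) * qq * (shiftProd qq qi (C.card - 1) 0 *
        forestPoly qq qi (D \ C).card qi), Finset.sum_erase _ (by simp),
      sum_powerset_shiftProd qq_ne_qi, Finset.card_insert_of_notMem hm, Nat.add_sub_cancel]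

theorem TreeSystem.exists_of_nonempty (S : Finset (Fin n)) (hS : S.Nonempty) :
    Nonempty (TreeSystem S) := by
  induction S using Finset.strongInduction with
  | H S ih =>
  obtain ⟨m, hm⟩ := hS
  have hlt : ∀ C ⊆ S.erase m, C ⊂ S := fun C hC => lt_of_le_of_lt hC (Finset.erase_ssubset hm)
  rw [← Finset.insert_erase hm]
  exact TreeSystem.nonempty_insert (Finset.notMem_erase m S)
    (fun C => (ih C.1 (hlt _ (Finset.mem_powerset.1 (Finset.mem_of_mem_erase C.2)))
      (Finset.nonempty_iff_ne_empty.2 (Finset.ne_of_mem_erase C.2))).some)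
    (fun Y hY => (ForestSystem.exists_of_trees Y (fun h => Finset.notMem_erase m S (hY h))
      fun C hC hne => ih C (hlt C (hC.trans hY)) hne).some)

theorem killHom_mon {P : Finset (Fin n)} {r : Fin n} (hr : r ∉ P) :
    ∀ {l : List (Bool × Fin n × Fin n)}, Inside P l → killHom r (mon l) = mon l
  | [], _ => by rw [mon_nil, map_one]
  | g :: l, h => by
    have hg := h _ List.mem_cons_self
    rw [mon_cons, map_mul, killHom_edge, killHom_mon hr fun g hg => h g (List.mem_cons_of_mem _ hg),
      if_neg]
    rintro (h | h)
    · exact hr (h ▸ hg.1)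
    · exact hr (h ▸ hg.2)

/-- A matrix entry vanishes if the blocks of the row and the column that contain `z` differ: the
contraction gives zero or leaves an edge at `r`. -/
theorem killHom_contr_eq_zero {r z : Fin n} {B B' E' : Finset (Fin n)} {G : Alg n →ₗ[ℚ] Alg n}
    (hB : B ⊆ B' ∪ E') (hd : Disjoint B' E') (hz : z ∈ B) (hz' : z ∈ B') (hne : B ≠ B')
    (hG : IsContr B r G) {a b : Alg n} (ha : IsTree B' a) (hb : ∃ l, Inside E' l ∧ mon l = b) :
    killHom r (G (a * b)) = 0 := by
  obtain ⟨l, hl, hlen, rfl⟩ := ha.exists_mon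
  obtain ⟨l', hl', rfl⟩ := hb
  by_cases hsub : B ⊆ B'
  · obtain ⟨c, y, hy, p, hp⟩ := hG.exists_edge ⟨z, hz⟩ (hsub.ssubset_of_ne hne) hl hlen
    rw [mul_comm, hG.pull hl' (fun v hv hvB =>
      absurd hv (Finset.disjoint_left.1 hd (hsub hvB))), hp, map_mul, map_mul, killHom_edge,
      if_pos (Or.inl rfl), zero_mul, mul_zero]
  · obtain ⟨v, hv, hv'⟩ := Finset.not_subset.1 hsub
    rw [hG.mon_mul_mon_eq_zero hd hB ⟨z, Finset.mem_inter.2 ⟨hz, hz'⟩⟩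
      ⟨v, Finset.mem_inter.2 ⟨hv, (Finset.mem_union.1 (hB hv)).resolve_left hv'⟩⟩ hl hl', map_zero]

/-- The value for equal blocks, from which the matrix of a system of forests is block diagonal with
Kronecker products as blocks. -/
theorem killHom_contr {r : Fin n} {B E : Finset (Fin n)} {G : Alg n →ₗ[ℚ] Alg n}
    (hd : Disjoint B E) (hr : r ∈ B) (hG : IsContr B r G) {a b : Alg n} (ha : IsTree B a)
    (hb : ∃ l, Inside E l ∧ mon l = b) : killHom r (G (a * b)) = aug n (G a) • b := by
  obtain ⟨l, hl, -, rfl⟩ := ha.exists_mon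
  obtain ⟨l', hl', rfl⟩ := hb
  rw [mul_comm, hG.pull hl' (fun v hv hvB => absurd hv (Finset.disjoint_left.1 hd hvB)),
    hG.scalar hl, mul_comm, ← Algebra.smul_def, map_smul,
    killHom_mon (Finset.disjoint_left.1 hd hr) hl']
  simp

/-- Systems of forests are built by choosing the vertex set of the tree that contains a given
vertex. -/
theorem PlainSystem.nonempty_cons {z : Fin n} {D : Finset (Fin n)} (hz : z ∈ D)
    (B : ∀ p : {p // p ∈ (D.erase z).powerset}, TreeSystem (insert z p.1))
    (F : ∀ p : {p // p ∈ (D.erase z).powerset}, PlainSystem (D.erase z \ p.1)) :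
    Nonempty (PlainSystem D) := by
  have hsub : ∀ p : {p // p ∈ (D.erase z).powerset}, insert z p.1 ⊆ D := fun p =>
    Finset.insert_subset hz ((Finset.mem_powerset.1 p.2).trans (Finset.erase_subset _ _))
  have hd : ∀ p : {p // p ∈ (D.erase z).powerset}, Disjoint (insert z p.1) (D.erase z \ p.1) :=
    fun p => Finset.disjoint_insert_left.2 ⟨fun h => by simp at h, Finset.disjoint_sdiff⟩
  have hu : ∀ p : {p // p ∈ (D.erase z).powerset},
      insert z p.1 ∪ (D.erase z \ p.1) = D := fun p => by
    rw [Finset.insert_union, Finset.union_sdiff_of_subset (Finset.mem_powerset.1 p.2),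
      Finset.insert_erase hz]
  refine ⟨{
    ι := Σ p : {p // p ∈ (D.erase z).powerset}, (B p).ι × (F p).ι
    fin := inferInstance
    elt := fun f => (B f.1).elt f.2.1 * (F f.1).elt f.2.2
    fn := fun f => (F f.1).fn f.2.2 ∘ₗ (killHom ((B f.1).rt f.2.1)).toLinearMap ∘ₗ
      (B f.1).op f.2.1
    wt := fun f => (B f.1).wt f.2.1 + (F f.1).wt f.2.2
    inside := ?_
    hasWeight := fun f => ((B f.1).hasWeight f.2.1).mul ((F f.1).hasWeight f.2.2)
    mem_span := ?_
    nondeg := ?_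
    count := ?_ }⟩
  · rintro ⟨p, t, f⟩
    obtain ⟨l, hl, -, h⟩ := ((B p).isTree t).exists_mon
    obtain ⟨l', hl', h'⟩ := (F p).inside f
    exact ⟨l ++ l', (hl.mono (hsub p)).append (hl'.mono (Finset.sdiff_subset.trans
      (Finset.erase_subset _ _))), by rw [mon_append, h, h']⟩
  · intro r a ha
    obtain ⟨X, b, d, Y, r', a', hb, hdX, hXY, ha', hzX, rfl, rfl, rfl⟩ := ha.exists_block hz
    obtain ⟨p, hp⟩ : ∃ p : {p // p ∈ ((X ∪ Y).erase z).powerset}, p.1 = X.erase z :=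
      ⟨⟨X.erase z, Finset.mem_powerset.2 (Finset.erase_subset_erase _ Finset.subset_union_left)⟩,
        rfl⟩
    have hpX : insert z p.1 = X := by rw [hp, Finset.insert_erase hzX]
    have hpY : (X ∪ Y).erase z \ p.1 = Y := by
      have h1 := hd p
      have h2 := hu p
      rw [hpX] at h1 h2
      rw [← Finset.union_sdiff_cancel_left h1, h2, Finset.union_sdiff_cancel_left hXY]
    refine mul_mul_mem_of_mem_span _ ((B p).mem_span b (by rwa [hpX]))
      ((F p).mem_span r' a' (by rwa [hpY])) ?_
    rintro - ⟨t, rfl⟩ - ⟨f, rfl⟩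
    rw [Pi.one_apply, one_mul]
    exact Submodule.subset_span ⟨⟨p, t, f⟩, rfl⟩
  · rintro c hc ⟨p, t', f'⟩
    refine (F p).nondeg (fun f => c ⟨p, t', f⟩) (fun f => ?_) f'
    refine (B p).sum_eq_zero (fun t f => c ⟨p, t, f⟩) _ (fun t => ?_) t'
    refine Eq.trans ?_ (hc ⟨p, t, f⟩)
    rw [Fintype.sum_sigma, Finset.sum_eq_single p, Fintype.sum_prod_type]
    · refine Finset.sum_congr rfl fun t' _ => Finset.sum_congr rfl fun f' _ => ?_
      simp only [LinearMap.comp_apply, AlgHom.toLinearMap_apply]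
      rw [killHom_contr (hd p) ((B p).rt_mem t) ((B p).contr t) ((B p).isTree t')
        ((F p).inside f'), map_smul, smul_eq_mul]
    · intro p' _ hp'
      refine Finset.sum_eq_zero fun ⟨t', f'⟩ _ => ?_
      simp only [LinearMap.comp_apply, AlgHom.toLinearMap_apply]
      rw [killHom_contr_eq_zero ((hsub p).trans (hu p').ge) (hd p') (Finset.mem_insert_self _ _)
        (Finset.mem_insert_self _ _) (fun h => hp' ?_) ((B p).contr t) ((B p').isTree t')
        ((F p').inside f'), map_zero, mul_zero]
      have hz1 : ∀ p : {p // p ∈ (D.erase z).powerset}, z ∉ p.1 := fun p h =>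
        Finset.notMem_erase z D (Finset.mem_powerset.1 p.2 h)
      exact Subtype.ext (by rw [← Finset.erase_insert (hz1 p), h, Finset.erase_insert (hz1 p')])
    · exact fun h => absurd (Finset.mem_univ _) h
  · have hcard : ∀ p : {p // p ∈ (D.erase z).powerset}, (insert z p.1).card - 1 = p.1.card :=
      fun p => by
        rw [Finset.card_insert_of_notMem fun h =>
          Finset.notMem_erase z D (Finset.mem_powerset.1 p.2 h), Nat.add_sub_cancel]
    have h1 : ∀ p, ∑ x : (B p).ι × (F p).ι, (T ((B p).wt x.1 + (F p).wt x.2) : ℤ[T;T⁻¹]) =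
        1 * (shiftProd qq qi p.1.card 0 * forestPoly qq qi (D.erase z \ p.1).card 1) := by
      intro p
      rw [← (F p).count, ← hcard p, ← (B p).count, Fintype.sum_prod_type, Finset.sum_mul_sum,
        one_mul]
      exact Finset.sum_congr rfl fun t _ => Finset.sum_congr rfl fun f _ =>
        LaurentPolynomial.T_add _ _
    rw [Fintype.sum_sigma]
    simp only [h1]
    rw [Finset.sum_coe_sort (D.erase z).powerset fun p => 1 * (shiftProd qq qi p.card 0 *
      forestPoly qq qi (D.erase z \ p).card 1), sum_powerset_forestPoly qq_ne_qi,
      Finset.card_erase_add_one hz]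

theorem PlainSystem.nonempty (D : Finset (Fin n)) : Nonempty (PlainSystem D) := by
  induction D using Finset.strongInduction with
  | H D ih =>
  rcases D.eq_empty_or_nonempty with rfl | ⟨z, hz⟩
  · exact ⟨PlainSystem.nil⟩
  exact PlainSystem.nonempty_cons hz
    (fun p => (TreeSystem.exists_of_nonempty _ (Finset.insert_nonempty _ _)).some)
    (fun p => (ih _ (lt_of_le_of_lt Finset.sdiff_subset (Finset.erase_ssubset hz))).some)

end Existence

/-! ### Characters and weight bases -/

section Characters

open LaurentPolynomial (T)

theorem two_zpow_ne {k m : ℤ} (h : k ≠ m) : (2 : ℚ) ^ k ≠ 2 ^ m := fun he =>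
  h (zpow_right_injective₀ (by norm_num) (by norm_num) he)

variable {V ι : Type*} [AddCommGroup V] [Module ℚ V] {ρ : Representation ℚ SL2 V} {wt : ι → ℤ}

theorem mem_weightSpace {m : ℤ} {v : V} :
    v ∈ weightSpace ρ m ↔ ∀ t : ℚˣ, ρ (torus t) v = ((t ^ m : ℚˣ) : ℚ) • v := by
  simp [weightSpace, Submodule.mem_iInf]

theorem weightSpace_le_eigenspace (m : ℤ) :
    weightSpace ρ m ≤ Module.End.eigenspace (ρ (torus (Units.mk0 2 two_ne_zero))) (2 ^ m) :=
  (iInf_le _ (Units.mk0 2 two_ne_zero)).trans (by simp)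

/-- If there is a basis of weight vectors, then a weight space is spanned by the basis vectors of
this weight, because the action of `diag(2, 1/2)` separates the weights. -/
theorem weightSpace_eq_span (b : Module.Basis ι ℚ V) (h : ∀ i, b i ∈ weightSpace ρ (wt i)) (m : ℤ) :
    weightSpace ρ m = Submodule.span ℚ (b '' {i | wt i = m}) := by
  classical
  refine le_antisymm (fun v hv => ?_) (Submodule.span_le.2 ?_)
  · rw [b.mem_span_image]
    intro i hi
    by_contra hne
    have h1 : ρ (torus (Units.mk0 2 two_ne_zero)) v = (2 : ℚ) ^ m • v :=
      Module.End.mem_eigenspace_iff.1 (weightSpace_le_eigenspace m hv)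
    have h2 : (b.coord i) ∘ₗ ρ (torus (Units.mk0 2 two_ne_zero)) = (2 : ℚ) ^ wt i • b.coord i := by
      refine b.ext fun j => ?_
      have h3 : ρ (torus (Units.mk0 2 two_ne_zero)) (b j) = (2 : ℚ) ^ wt j • b j :=
        Module.End.mem_eigenspace_iff.1 (weightSpace_le_eigenspace _ (h j))
      rw [LinearMap.comp_apply, h3, map_smul, LinearMap.smul_apply, b.coord_apply, b.repr_self,
        Finsupp.single_apply]
      split_ifs with hij
      · rw [hij]
      · simp
    have h3 := LinearMap.congr_fun h2 v
    rw [LinearMap.comp_apply, h1, map_smul, LinearMap.smul_apply] at h3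
    refine Finsupp.mem_support_iff.1 hi ?_
    have h4 : ((2 : ℚ) ^ m - 2 ^ wt i) * b.coord i v = 0 := by
      rw [sub_mul, sub_eq_zero]
      exact h3
    exact (mul_eq_zero.1 h4).resolve_left (sub_ne_zero.2 (two_zpow_ne fun h => hne h.symm))
  · rintro - ⟨i, hi, rfl⟩
    rw [← (show wt i = m from hi)]
    exact h i

theorem isInternal_weightSpace (b : Module.Basis ι ℚ V) (h : ∀ i, b i ∈ weightSpace ρ (wt i)) :
    DirectSum.IsInternal fun m : ℤ => weightSpace ρ m := by
  refine DirectSum.isInternal_submodule_of_iSupIndep_of_iSup_eq_top ?_ ?_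
  · have h1 := (Module.End.eigenspaces_iSupIndep (ρ (torus (Units.mk0 2 two_ne_zero)))).comp
      (f := fun m : ℤ => (2 : ℚ) ^ m) (fun k m hkm => by
        by_contra hne
        exact two_zpow_ne hne hkm)
    exact h1.mono fun m => weightSpace_le_eigenspace m
  · rw [eq_top_iff, ← b.span_eq, Submodule.span_le]
    rintro - ⟨i, rfl⟩
    exact Submodule.mem_iSup_of_mem (wt i) (h i)

/-- The character counts the elements of a basis of weight vectors by their weights. -/
theorem character_eq_sum [Fintype ι] (b : Module.Basis ι ℚ V)
    (h : ∀ i, b i ∈ weightSpace ρ (wt i)) : character ρ = ∑ i, (T (wt i) : ℤ[T;T⁻¹]) := by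
  classical
  have hrank : ∀ m, Module.finrank ℚ (weightSpace ρ m) =
      (Finset.univ.filter fun i => wt i = m).card := by
    intro m
    have h1 : b '' {i | wt i = m} = Set.range (b ∘ (Subtype.val : {i // wt i = m} → ι)) := by
      rw [Set.image_eq_range]
      rfl
    rw [weightSpace_eq_span b h, h1, finrank_span_eq_card
      (b.linearIndependent.comp _ Subtype.val_injective), Fintype.card_subtype]
  rw [character, finsum_eq_sum_of_support_subset (s := Finset.univ.image wt)]
  · rw [← Finset.sum_fiberwise_of_maps_to (t := Finset.univ.image wt) (g := wt)
      fun i hi => Finset.mem_image_of_mem wt hi]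
    refine Finset.sum_congr rfl fun m _ => ?_
    rw [hrank, Finset.sum_congr rfl fun i hi => by rw [(Finset.mem_filter.1 hi).2],
      Finset.sum_const, nsmul_eq_mul]
    simp
  · intro m hm
    by_contra hne
    refine hm ?_
    simp only
    rw [hrank, Finset.card_eq_zero.2, Nat.cast_zero, map_zero, zero_mul]
    refine Finset.filter_eq_empty_iff.2 fun i _ hi => hne ?_
    exact Finset.mem_coe.2 (hi ▸ Finset.mem_image_of_mem wt (Finset.mem_univ i))

end Characters

/-! ### The basis of forests -/

section Basis

variable {n : ℕ}

theorem span_mon : Submodule.span ℚ (Set.range (mon (n := n))) = ⊤ := by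
  refine Submodule.eq_top_iff'.2 fun a => ?_
  obtain ⟨p, rfl⟩ : ∃ p, mkAlg n p = a := Ideal.Quotient.mk_surjective a
  have hedge : ∀ c i j, ∀ x ∈ Submodule.span ℚ (Set.range (mon (n := n))),
      x * edge c i j ∈ Submodule.span ℚ (Set.range (mon (n := n))) := by
    intro c i j x hx
    induction hx using Submodule.span_induction with
    | mem x hx =>
      obtain ⟨l, rfl⟩ := hx
      exact Submodule.subset_span ⟨(c, i, j) :: l, by rw [mon_cons, mul_comm]⟩
    | zero => rw [zero_mul]; exact zero_mem _
    | add x y _ _ hx hy => rw [add_mul]; exact add_mem hx hy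
    | smul t x _ hx => rw [smul_mul_assoc]; exact Submodule.smul_mem _ _ hx
  induction p using MvPolynomial.induction_on with
  | C r =>
    rw [← MvPolynomial.algebraMap_eq, AlgHom.commutes, Algebra.algebraMap_eq_smul_one]
    exact Submodule.smul_mem _ _ (Submodule.subset_span ⟨[], mon_nil⟩)
  | add p q hp hq => rw [map_add]; exact add_mem hp hq
  | mul_X p g hp =>
    rw [map_mul]
    cases g with
    | x i j h =>
      have := hedge true i j _ hp
      rwa [edge, dif_neg h] at this
    | y i j h =>
      have := hedge false i j _ hp
      rwa [edge, dif_neg h] at this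

/-- The basis of the double even Orlik–Solomon algebra given by a system of forests on all
points. -/
def PlainSystem.basis (P : PlainSystem (Finset.univ : Finset (Fin n))) :
    Module.Basis P.ι ℚ (Alg n) :=
  Module.Basis.mk (v := P.elt)
    (Fintype.linearIndependent_iff.2 fun c hc => P.nondeg c fun f => by
      have := congrArg (P.fn f) hc
      simpa using this)
    (by
      rw [← span_mon, Submodule.span_le]
      rintro - ⟨l, rfl⟩
      rcases mon_eq_zero_or_part (P := Finset.univ) (l := l) (fun g _ => by simp) with h | ⟨r, h, -⟩
      · rw [h]
        exact zero_mem _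
      · exact P.mem_span r _ h)

/-- The action of `diag(t, t⁻¹)` on `OS2Plus n` agrees with `scale t` on the sealed copy. -/
theorem act_torus (t : ℚˣ) (a : Alg n) : act (n := n) (torus t) a = scale t a := by
  let A : Alg n →ₐ[ℚ] Alg n := act (n := n) (torus t)
  have hA : ∀ p, A (mkAlg n p) = mkAlg n (freeAct (torus t) p) := fun p => rfl
  suffices A = scale t from congrArg (fun f : Alg n →ₐ[ℚ] Alg n => f a) this
  refine algHom_ext fun c i j hij => ?_
  rw [scale_edge, edge, dif_neg hij, hA, ← map_smul]
  congr 1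
  cases c <;> simp [freeAct, genAct, torus, MvPolynomial.smul_eq_C_mul]

theorem forestPoly_one (n : ℕ) : forestPoly qq qi n 1 = ∏ k ∈ Finset.Ico 1 n,
    (1 + LaurentPolynomial.C (k : ℤ) * LaurentPolynomial.T 1
      + LaurentPolynomial.C ((n : ℤ) - (k : ℤ)) * LaurentPolynomial.T (-1)) := by
  cases n with
  | zero => simp [forestPoly]
  | succ m =>
    rw [forestPoly, one_mul, shiftProd, Finset.prod_Ico_eq_prod_range, Nat.add_sub_cancel]
    refine Finset.prod_congr rfl fun k _ => ?_
    simp only [map_sub, map_natCast]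
    push_cast
    ring

end Basis

end DoubleOS

end

theorem mainTheorem8 (n : ℕ) :
    Module.Finite ℚ (DoubleOS.OS2Plus n) ∧
    DirectSum.IsInternal (fun m : ℤ => DoubleOS.weightSpace (DoubleOS.rep n) m) ∧
    DoubleOS.character (DoubleOS.rep n) =
      ∏ k ∈ Finset.Ico 1 n,
        (1 + LaurentPolynomial.C (k : ℤ) * LaurentPolynomial.T 1
          + LaurentPolynomial.C ((n : ℤ) - (k : ℤ)) * LaurentPolynomial.T (-1)) := by
  obtain ⟨P⟩ := DoubleOS.PlainSystem.nonempty (Finset.univ : Finset (Fin n))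
  let b : Module.Basis P.ι ℚ (DoubleOS.OS2Plus n) := P.basis
  have hb : ∀ f, b f ∈ DoubleOS.weightSpace (DoubleOS.rep n) (P.wt f) := fun f =>
    DoubleOS.mem_weightSpace.2 fun t => by
      have h1 : P.basis f = P.elt f := Module.Basis.mk_apply _ _ _
      have h2 := P.hasWeight f t
      rw [← h1, ← DoubleOS.act_torus] at h2
      exact h2
  refine ⟨Module.Finite.of_basis b, DoubleOS.isInternal_weightSpace b hb, ?_⟩
  rw [DoubleOS.character_eq_sum b hb, P.count, Finset.card_univ, Fintype.card_fin,
    DoubleOS.forestPoly_one]
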